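/- Let $D\subset\mathbf R^n$ be a bounded simply connected domain with $C^1$-smooth boundary and let $T>0$. Let $f:\mathbf R^n\times\mathbf R\to\mathbf R^n$ be a bounded continuous function whose first-order partial derivatives with respect to $x$ exist and are continuous in $(x,t)$. For $x\in D$ and $s\in[0,T]$ let $y^{x,s}(t)$, $t\ge s$, be the solution of $$\frac{dy}{dt}(t)=f(y(t),t),\qquad y(s)=x,$$ and put $$\tilde\tau^{x,s}=\inf\{t\ge s:\ y^{x,s}(t)\notin D\}\quad(\inf\emptyset=+\infty),\qquad \tau^{x,s}=\min\{T,\tilde\tau^{x,s}\}.$$ Let $\varphi:\bar D\times[0,T]\to\mathbf R$ be Lebesgue measurable with $\int_0^T\|\varphi(\cdot,t)\|_{L_2(D)}\,dt<\infty$, let $\zeta:\bar D\to\mathbf R$ be Lebesgue measurable with $\zeta\in L_2(D)$, and define for $x\in D$, $s\in[0,T]$ $$V(x,s)=\int_s^{\tau^{x,s}}\varphi(y^{x,s}(t),t)\,dt,\qquad U(x,s)=\begin{cases}\zeta(y^{x,s}(T)),&\tilde\tau^{x,s}>T,\\ 0,&\tilde\tau^{x,s}\le T.\end{cases}$$ Then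 for every $s\in[0,T]$ the integral defining $V(x,s)$ converges absolutely for almost every $x\in D$, the functions $V(\cdot,s)$ and $U(\cdot,s)$ belong to $L_2(D)$, and the maps $s\mapsto V(\cdot,s)$ and $s\mapsto U(\cdot,s)$ are weakly continuous from $[0,T]$ to $L_2(D)$ and strongly left-continuous: for every $t\in(0,T]$, $\|V(\cdot,t)-V(\cdot,\theta)\|_{L_2(D)}\to0$ and $\|U(\cdot,t)-U(\cdot,\theta)\|_{L_2(D)}\to0$ as $\theta\to t-0$. Moreover, $$\sup_{s\in[0,T]}\|V(\cdot,s)\|_{L_2(D)}\le c_0\int_0^T\|\varphi(\cdot,t)\|_{L_2(D)}\,dt,\qquad \sup_{s\in[0,T]}\|U(\cdot,s)\|_{L_2(D)}\le c_0\|\zeta\|_{L_2(D)},$$ where $$c_0=\exp\left(\frac12\int_0^T\sup_{x\in D}\left|\sum_{i=1}^n\frac{\partial f_i}{\partial x_i}(x,t)\right|dt\right).$$ -/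

import Mathlib

open MeasureTheory Set Filter Topology
open scoped ENNReal

noncomputable section

namespace ExitFlow

/-- The boundary of the open set `D` is of class `C^1`: near each boundary point, `D` is the
sublevel set `{g < 0}` of a `C^1` function `g` with nonvanishing differential. -/
def HasC1Boundary {n : ℕ} (D : Set (EuclideanSpace ℝ (Fin n))) : Prop :=
  ∀ x₀ ∈ frontier D, ∃ (W : Set (EuclideanSpace ℝ (Fin n))) (g : EuclideanSpace ℝ (Fin n) → ℝ),
    IsOpen W ∧ x₀ ∈ W ∧ ContDiffOn ℝ 1 g W ∧ (∀ x ∈ W, fderiv ℝ g x ≠ 0) ∧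
      ∀ x ∈ W, x ∈ D ↔ g x < 0

/-- A bounded simply connected domain with `C^1` boundary. -/
structure IsC1Domain {n : ℕ} (D : Set (EuclideanSpace ℝ (Fin n))) : Prop where
  isOpen : IsOpen D
  isBounded : Bornology.IsBounded D
  simplyConnected : IsSimplyConnected D
  c1_boundary : HasC1Boundary D

/-- A bounded continuous time-dependent vector field whose first-order derivatives with respect
to the space variable exist and are continuous in space and time. -/
structure IsC1Field {n : ℕ}
    (f : EuclideanSpace ℝ (Fin n) → ℝ → EuclideanSpace ℝ (Fin n)) : Prop where
  bounded : ∃ M : ℝ, ∀ x t, ‖f x t‖ ≤ M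
  continuous : Continuous (fun p : EuclideanSpace ℝ (Fin n) × ℝ => f p.1 p.2)
  differentiable : ∀ t, Differentiable ℝ (fun x => f x t)
  continuous_fderiv : Continuous
    (fun p : EuclideanSpace ℝ (Fin n) × ℝ => fderiv ℝ (fun x => f x p.2) p.1)

/-- `y` solves `dy/dt (t) = f (y t, t)` for `t ≥ s` with `y s = x` (the derivative at `t = s` is
one-sided). -/
def IsTrajectory {n : ℕ} (f : EuclideanSpace ℝ (Fin n) → ℝ → EuclideanSpace ℝ (Fin n))
    (x : EuclideanSpace ℝ (Fin n)) (s : ℝ) (y : ℝ → EuclideanSpace ℝ (Fin n)) : Prop :=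
  y s = x ∧ ∀ t, s ≤ t → HasDerivWithinAt y (f (y t) t) (Ici s) t

/-- The solution `y^{x,s}`. For a field satisfying `IsC1Field` it exists on `[s, ∞)` and is unique
there; values at times before `s` are never used. -/
def trajectory {n : ℕ} (f : EuclideanSpace ℝ (Fin n) → ℝ → EuclideanSpace ℝ (Fin n))
    (x : EuclideanSpace ℝ (Fin n)) (s : ℝ) : ℝ → EuclideanSpace ℝ (Fin n) :=
  Classical.epsilon (IsTrajectory f x s)

/-- The first exit time `inf {t ≥ s : y^{x,s}(t) ∉ D}`, equal to `⊤` if there is no exit. -/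
def exitTime {n : ℕ} (f : EuclideanSpace ℝ (Fin n) → ℝ → EuclideanSpace ℝ (Fin n))
    (D : Set (EuclideanSpace ℝ (Fin n))) (x : EuclideanSpace ℝ (Fin n)) (s : ℝ) : EReal :=
  sInf ((fun t : ℝ => (t : EReal)) '' {t : ℝ | s ≤ t ∧ trajectory f x s t ∉ D})

/-- The exit time truncated at `T`; a real number, as it lies in `[s, T]` when `s ≤ T`. -/
def stoppedTime {n : ℕ} (f : EuclideanSpace ℝ (Fin n) → ℝ → EuclideanSpace ℝ (Fin n))
    (D : Set (EuclideanSpace ℝ (Fin n))) (T : ℝ) (x : EuclideanSpace ℝ (Fin n)) (s : ℝ) : ℝ :=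
  (min (T : EReal) (exitTime f D x s)).toReal

/-- `U(x, s)`: the value of `ζ` at `y^{x,s}(T)` if the exit time exceeds `T`, and `0` otherwise. -/
def terminalFunctional {n : ℕ}
    (f : EuclideanSpace ℝ (Fin n) → ℝ → EuclideanSpace ℝ (Fin n))
    (D : Set (EuclideanSpace ℝ (Fin n))) (T : ℝ) (ζ : EuclideanSpace ℝ (Fin n) → ℝ)
    (x : EuclideanSpace ℝ (Fin n)) (s : ℝ) : ℝ :=
  {z | (T : EReal) < exitTime f D z s}.indicator (fun z => ζ (trajectory f z s T)) x

/-- `V(x, s)`: the integral of `φ(y^{x,s}(t), t)` from `s` to the truncated exit time. -/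
def integralFunctional {n : ℕ}
    (f : EuclideanSpace ℝ (Fin n) → ℝ → EuclideanSpace ℝ (Fin n))
    (D : Set (EuclideanSpace ℝ (Fin n))) (T : ℝ) (φ : EuclideanSpace ℝ (Fin n) → ℝ → ℝ)
    (x : EuclideanSpace ℝ (Fin n)) (s : ℝ) : ℝ :=
  ∫ t in s..stoppedTime f D T x s, φ (trajectory f x s t) t

/-- The divergence in the space variable, `∑ᵢ ∂fᵢ/∂xᵢ (x, t)`. -/
def divergence {n : ℕ} (f : EuclideanSpace ℝ (Fin n) → ℝ → EuclideanSpace ℝ (Fin n))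
    (x : EuclideanSpace ℝ (Fin n)) (t : ℝ) : ℝ :=
  ∑ i : Fin n, (fderiv ℝ (fun z => f z t) x (EuclideanSpace.single i 1)) i

/-- The constant `exp (½ ∫₀ᵀ sup_{x ∈ D} |div f(x, t)| dt)`. -/
def growthConstant {n : ℕ} (f : EuclideanSpace ℝ (Fin n) → ℝ → EuclideanSpace ℝ (Fin n))
    (D : Set (EuclideanSpace ℝ (Fin n))) (T : ℝ) : ℝ :=
  Real.exp ((1 / 2) * ∫ t in (0 : ℝ)..T, (⨆ x : D, |divergence f x t|))

/-- The family `s ↦ w(·, s)`, `s ∈ [0, T]`, consists of elements of `L₂(D)` and is continuous for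
the weak topology of `L₂(D)`. -/
def WeaklyContinuousL2 {n : ℕ} (D : Set (EuclideanSpace ℝ (Fin n))) (T : ℝ)
    (w : EuclideanSpace ℝ (Fin n) → ℝ → ℝ) : Prop :=
  (∀ s ∈ Icc 0 T, MemLp (fun x => w x s) 2 (volume.restrict D)) ∧
    ∀ ξ : EuclideanSpace ℝ (Fin n) → ℝ, MemLp ξ 2 (volume.restrict D) →
      ContinuousOn (fun s => ∫ x in D, ξ x * w x s) (Icc 0 T)

/-- The family `s ↦ w(·, s)`, `s ∈ [0, T]`, consists of elements of `L₂(D)` and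
`‖w(·, t) - w(·, θ)‖ → 0` in `L₂(D)` as `θ → t - 0`. -/
def StronglyLeftContinuousL2 {n : ℕ} (D : Set (EuclideanSpace ℝ (Fin n))) (T : ℝ)
    (w : EuclideanSpace ℝ (Fin n) → ℝ → ℝ) : Prop :=
  (∀ s ∈ Icc 0 T, MemLp (fun x => w x s) 2 (volume.restrict D)) ∧
    ∀ t ∈ Ioc 0 T, Tendsto (fun θ => eLpNorm (fun x => w x t - w x θ) 2 (volume.restrict D))
      (𝓝[Ico 0 t] t) (𝓝 0)

end ExitFlow

end

/-!
Write `Φ_{s,t}` for the flow of `f` (`flow`) and `A_{s,t}` (`survivalSet`) for the set of points whose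
trajectory stays in `D` between the times `s` and `t`, in either order. The operators
`T_{s,t} g = 1_{A_{s,t}} · (g ∘ Φ_{s,t})` (`transport`) satisfy `T_{s,r} T_{r,t} = T_{s,t}` for
`s ≤ r ≤ t`, and for starting points in `D` one has `U(s) = T_{s,T} ζ` and
`V(s) = ∫_s^T T_{s,t} φ(t) dt`.

*Bounds.* By Liouville's formula (`IsC1Field.exists_hasFDerivAt_flow`) the Jacobian determinant of
the flow is the exponential of the integrated divergence. On `A_{s,t}` the trajectory stays in `D`,
where the divergence is at most its supremum over `D`, so that `T_{s,t}` is bounded on `L₂(D)` by the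
growth constant (`IsC1Field.eLpNorm_transport_le`). This bounds `U`, and with Minkowski's integral
inequality (`eLpNorm_integral_le`) it bounds `V` and gives the almost everywhere convergence of the
integral.

*Continuity.* As `t - s → 0`, `T_{s,t} g → g` in `L₂(D)`, for either order of the times
(`IsC1Field.tendsto_transport`): this is clear for continuous `g`, and these are dense. Both
functionals satisfy `w(a) = T_{a,b} w(b) + o(1)` for `a ≤ b` as `b - a → 0`, where the error is zero
for `U` and `∫_a^b T_{a,t} φ(t) dt` for `V`. Left-continuity at `b` follows directly. For weak
continuity one moves `T_{a,b}` to the test function: its adjoint is `T_{b,a}` up to the factor given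
by the Jacobian determinant, which tends to `1` uniformly
(`IsC1Field.enorm_integral_transport_sub_le`). The two conclusions are drawn together in
`IsC1Field.continuity_of_transport`.

The regularity of the boundary of `D` plays no role here, because a trajectory that starts at a point
of the open set `D` needs a positive time to leave `D`.
-/

namespace ExitFlow


/-! ### The flow of a bounded `C¹` field -/

section Flow

variable {n : ℕ} {f : EuclideanSpace ℝ (Fin n) → ℝ → EuclideanSpace ℝ (Fin n)}

lemma IsC1Field.exists_speed (hf : IsC1Field f) : ∃ M : NNReal, ∀ x t, ‖f x t‖ ≤ M := by
  obtain ⟨M, hM⟩ := hf.bounded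
  exact ⟨M.toNNReal, fun x t => (hM x t).trans (Real.le_coe_toNNReal M)⟩

lemma IsC1Field.exists_norm_fderiv_le (hf : IsC1Field f) {K : Set (EuclideanSpace ℝ (Fin n))}
    (hK : IsCompact K) (a b : ℝ) :
    ∃ C : NNReal, ∀ x ∈ K, ∀ t ∈ Icc a b, ‖fderiv ℝ (fun z => f z t) x‖ ≤ C := by
  obtain ⟨C, hC⟩ := (hK.prod (isCompact_Icc (a := a) (b := b))).exists_bound_of_continuousOn
    hf.continuous_fderiv.continuousOn
  exact ⟨C.toNNReal, fun x hx t ht => (hC (x, t) ⟨hx, ht⟩).trans (Real.le_coe_toNNReal C)⟩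

lemma IsC1Field.exists_lipschitzOnWith (hf : IsC1Field f) (x : EuclideanSpace ℝ (Fin n))
    (R a b : ℝ) :
    ∃ K : NNReal, ∀ t ∈ Icc a b,
      LipschitzOnWith K (fun z => f z t) (Metric.closedBall x R) := by
  obtain ⟨C, hC⟩ := hf.exists_norm_fderiv_le (isCompact_closedBall x R) a b
  refine ⟨C, fun t ht => ?_⟩
  exact (convex_closedBall x R).lipschitzOnWith_of_nnnorm_fderiv_le
    (fun z _ => hf.differentiable t z) (fun z hz => hC z hz t ht)

lemma IsC1Field.isPicardLindelof (hf : IsC1Field f) {M : NNReal} (hM : ∀ x t, ‖f x t‖ ≤ M)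
    (x : EuclideanSpace ℝ (Fin n)) (s : ℝ) (r N : NNReal) :
    ∃ K : NNReal, IsPicardLindelof (fun t z => f z t) (tmin := s - N) (tmax := s + N)
      ⟨s, by constructor <;> simp⟩ x (r + M * N) r M K := by
  obtain ⟨K, hK⟩ := hf.exists_lipschitzOnWith x (r + M * N : NNReal) (s - N) (s + N)
  refine ⟨K, hK, fun z _ => ?_, fun t _ z _ => hM z t, ?_⟩
  · exact (hf.continuous.comp (by fun_prop : Continuous fun t : ℝ => (z, t))).continuousOn
  · simp

/-- Two solutions on an open interval that agree at one time agree: their speed is bounded, so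
both stay in a fixed ball, on which the field is Lipschitz. -/
lemma IsC1Field.eqOn_Ioo (hf : IsC1Field f) {a b s : ℝ} (hs : s ∈ Ioo a b)
    {α β : ℝ → EuclideanSpace ℝ (Fin n)}
    (hα : ∀ t ∈ Ioo a b, HasDerivAt α (f (α t) t) t)
    (hβ : ∀ t ∈ Ioo a b, HasDerivAt β (f (β t) t) t) (h : α s = β s) : EqOn α β (Ioo a b) := by
  obtain ⟨M, hM⟩ := hf.exists_speed
  obtain ⟨K, hK⟩ := hf.exists_lipschitzOnWith (α s) (M * (b - a)) a b
  have key : ∀ γ : ℝ → EuclideanSpace ℝ (Fin n),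
      (∀ t ∈ Ioo a b, HasDerivAt γ (f (γ t) t) t) → γ s = α s →
      ∀ t ∈ Ioo a b, γ t ∈ Metric.closedBall (α s) (M * (b - a)) := by
    intro γ hγ h0 t ht
    have := (convex_Ioo a b).norm_image_sub_le_of_norm_hasDerivWithin_le
      (fun t ht => (hγ t ht).hasDerivWithinAt) (fun t _ => hM (γ t) t) hs ht
    rw [mem_closedBall_iff_norm, ← h0]
    refine this.trans ?_
    gcongr
    rw [Real.norm_eq_abs, abs_le]
    constructor <;> linarith [hs.1, hs.2, ht.1, ht.2]
  exact ODE_solution_unique_of_mem_Ioo (v := fun t z => f z t)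
    (fun t ht => hK t (Ioo_subset_Icc_self ht)) hs
    (fun t ht => ⟨hα t ht, key α hα rfl t ht⟩) (fun t ht => ⟨hβ t ht, key β hβ h.symm t ht⟩) h

lemma IsC1Field.exists_solution (hf : IsC1Field f) (s : ℝ) (x : EuclideanSpace ℝ (Fin n)) :
    ∃ y : ℝ → EuclideanSpace ℝ (Fin n), y s = x ∧ ∀ t, HasDerivAt y (f (y t) t) t := by
  obtain ⟨M, hM⟩ := hf.exists_speed
  have loc : ∀ N : NNReal, ∃ α : ℝ → EuclideanSpace ℝ (Fin n), α s = x ∧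
      ∀ t ∈ Ioo (s - N) (s + N), HasDerivAt α (f (α t) t) t := by
    intro N
    obtain ⟨K, hK⟩ := hf.isPicardLindelof hM x s 0 N
    obtain ⟨α, h0, hα⟩ := hK.exists_eq_forall_mem_Icc_hasDerivWithinAt₀
    exact ⟨α, h0, fun t ht => (hα t (Ioo_subset_Icc_self ht)).hasDerivAt
      (Icc_mem_nhds ht.1 ht.2)⟩
  choose α h0 hα using loc
  have hN : ∀ t, ∃ N : NNReal, (N : ℝ) = |t - s| + 1 := fun t =>
    ⟨⟨|t - s| + 1, by positivity⟩, rfl⟩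
  choose N hN using hN
  -- solutions on nested intervals agree, so that they glue to a global one
  refine ⟨fun t => α (N t) t, h0 _, fun t => ?_⟩
  have hloc : (fun t => α (N t) t) =ᶠ[𝓝 t] α (N t + 1) := by
    filter_upwards [Metric.ball_mem_nhds t one_pos] with t' ht'
    rw [Metric.mem_ball, Real.dist_eq] at ht'
    have h1 : |t' - s| ≤ |t' - t| + |t - s| := abs_sub_le _ _ _
    have h2 := abs_nonneg (t' - s)
    have h3 := le_abs_self (t' - s)
    have h4 := neg_abs_le (t' - s)
    refine hf.eqOn_Ioo (a := s - N t') (b := s + N t') (s := s) ?_ (hα _) (fun r hr => hα _ r ?_)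
      ((h0 _).trans (h0 _).symm) ?_
    · rw [hN]; constructor <;> linarith
    · push_cast
      rw [hN] at hr ⊢
      constructor <;> linarith [hr.1, hr.2]
    · rw [hN]; constructor <;> linarith
  have h3 := le_abs_self (t - s)
  have h4 := neg_abs_le (t - s)
  have := hα (N t + 1) t (by push_cast; rw [hN]; constructor <;> linarith)
  rw [← hloc.eq_of_nhds] at this
  exact this.congr_of_eventuallyEq hloc

/-- The flow `Φ_{s,t}` of `f`: `flow f s t x` is the value at time `t`, which may precede `s`, of
the solution that passes through `x` at time `s`. -/
noncomputable def flow (f : EuclideanSpace ℝ (Fin n) → ℝ → EuclideanSpace ℝ (Fin n)) (s t : ℝ)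
    (x : EuclideanSpace ℝ (Fin n)) : EuclideanSpace ℝ (Fin n) :=
  Classical.epsilon (fun y : ℝ → EuclideanSpace ℝ (Fin n) =>
    y s = x ∧ ∀ t, HasDerivAt y (f (y t) t) t) t

lemma IsC1Field.flow_self (hf : IsC1Field f) (s : ℝ) (x : EuclideanSpace ℝ (Fin n)) :
    flow f s s x = x :=
  (Classical.epsilon_spec (hf.exists_solution s x)).1

lemma IsC1Field.hasDerivAt_flow (hf : IsC1Field f) (s : ℝ) (x : EuclideanSpace ℝ (Fin n))
    (t : ℝ) : HasDerivAt (fun r => flow f s r x) (f (flow f s t x) t) t :=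
  (Classical.epsilon_spec (hf.exists_solution s x)).2 t

lemma IsC1Field.eq_flow (hf : IsC1Field f) {a b s : ℝ} (hs : s ∈ Ioo a b)
    {y : ℝ → EuclideanSpace ℝ (Fin n)} (hy : ∀ t ∈ Ioo a b, HasDerivAt y (f (y t) t) t) {t : ℝ}
    (ht : t ∈ Ioo a b) : y t = flow f s t (y s) :=
  hf.eqOn_Ioo hs hy (fun t _ => hf.hasDerivAt_flow s _ t) (hf.flow_self s _).symm ht

lemma IsC1Field.flow_flow (hf : IsC1Field f) (s r t : ℝ) (x : EuclideanSpace ℝ (Fin n)) :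
    flow f r t (flow f s r x) = flow f s t x := by
  refine (hf.eq_flow (a := min r t - 1) (b := max r t + 1) (s := r) (y := fun r => flow f s r x)
    ?_ (fun t _ => hf.hasDerivAt_flow s x t) ?_).symm
  · constructor <;> linarith [min_le_left r t, le_max_left r t]
  · constructor <;> linarith [min_le_right r t, le_max_right r t]

lemma IsC1Field.flow_flow_self (hf : IsC1Field f) (s t : ℝ) (x : EuclideanSpace ℝ (Fin n)) :
    flow f t s (flow f s t x) = x := by
  rw [hf.flow_flow, hf.flow_self]

lemma IsC1Field.norm_flow_sub_le (hf : IsC1Field f) {M : NNReal} (hM : ∀ x t, ‖f x t‖ ≤ M)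
    (s t : ℝ) (x : EuclideanSpace ℝ (Fin n)) : ‖flow f s t x - x‖ ≤ M * |t - s| := by
  have := convex_univ.norm_image_sub_le_of_norm_hasDerivWithin_le
      (fun t _ => (hf.hasDerivAt_flow s x t).hasDerivWithinAt) (fun t _ => hM (flow f s t x) t)
      (mem_univ s) (mem_univ t)
  rwa [hf.flow_self] at this

lemma IsC1Field.continuous_flow_time (hf : IsC1Field f) (s : ℝ) (x : EuclideanSpace ℝ (Fin n)) :
    Continuous fun t => flow f s t x :=
  continuous_iff_continuousAt.2 fun t => (hf.hasDerivAt_flow s x t).continuousAt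

lemma IsC1Field.continuous_flow (hf : IsC1Field f) (s : ℝ) :
    Continuous fun p : ℝ × EuclideanSpace ℝ (Fin n) => flow f s p.1 p.2 := by
  obtain ⟨M, hM⟩ := hf.exists_speed
  rw [continuous_iff_continuousAt]
  rintro ⟨t, x⟩
  obtain ⟨N, hN⟩ : ∃ N : NNReal, (N : ℝ) = |t - s| + 1 := ⟨⟨|t - s| + 1, by positivity⟩, rfl⟩
  obtain ⟨K, hK⟩ := hf.isPicardLindelof hM x s 1 N
  obtain ⟨α, hα, hc⟩ := hK.exists_forall_mem_closedBall_eq_hasDerivWithinAt_continuousOn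
  have h3 := le_abs_self (t - s)
  have h4 := neg_abs_le (t - s)
  have ht : t ∈ Ioo (s - N) (s + N) := by rw [hN]; constructor <;> linarith
  have hs : s ∈ Ioo (s - N) (s + N) := by
    rw [hN]; constructor <;> linarith [abs_nonneg (t - s)]
  have hc' : ContinuousAt α (x, t) :=
    hc.continuousAt (prod_mem_nhds (Metric.closedBall_mem_nhds x (by simp))
      (Icc_mem_nhds ht.1 ht.2))
  have hc'' : ContinuousAt (fun p : ℝ × EuclideanSpace ℝ (Fin n) => α (p.2, p.1)) (t, x) :=
    ContinuousAt.comp (g := α)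
      (f := fun p : ℝ × EuclideanSpace ℝ (Fin n) => (p.2, p.1)) hc' (by fun_prop)
  refine hc''.congr ?_
  filter_upwards [prod_mem_nhds (Ioo_mem_nhds ht.1 ht.2)
    (Metric.closedBall_mem_nhds x (one_pos : (0 : ℝ) < 1))] with p hp
  have h := hα p.2 (by simpa using hp.2)
  have := hf.eq_flow hs (y := fun r => α (p.2, r))
    (fun r hr => (h.2 r (Ioo_subset_Icc_self hr)).hasDerivAt (Icc_mem_nhds hr.1 hr.2)) hp.1
  rw [this]
  congr 1
  exact h.1

lemma IsC1Field.isTrajectory_flow (hf : IsC1Field f) (s : ℝ) (x : EuclideanSpace ℝ (Fin n)) :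
    IsTrajectory f x s (fun t => flow f s t x) :=
  ⟨hf.flow_self s x, fun t _ => (hf.hasDerivAt_flow s x t).hasDerivWithinAt⟩

lemma IsC1Field.trajectory_eq_flow (hf : IsC1Field f) {s t : ℝ} (hst : s ≤ t)
    (x : EuclideanSpace ℝ (Fin n)) : trajectory f x s t = flow f s t x := by
  have hy : IsTrajectory f x s (trajectory f x s) :=
    Classical.epsilon_spec ⟨_, hf.isTrajectory_flow s x⟩
  obtain ⟨M, hM⟩ := hf.exists_speed
  obtain ⟨K, hK⟩ := hf.exists_lipschitzOnWith x (M * (t - s)) s t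
  have key : ∀ γ : ℝ → EuclideanSpace ℝ (Fin n), IsTrajectory f x s γ →
      ∀ r ∈ Ico s t, γ r ∈ Metric.closedBall x (M * (t - s)) := by
    intro γ hγ r hr
    have := (convex_Icc s t).norm_image_sub_le_of_norm_hasDerivWithin_le
      (fun r hr => (hγ.2 r hr.1).mono Icc_subset_Ici_self) (fun r _ => hM (γ r) r)
      (left_mem_Icc.2 hst) (Ico_subset_Icc_self hr)
    rw [hγ.1] at this
    rw [mem_closedBall_iff_norm]
    refine this.trans ?_
    gcongr
    rw [Real.norm_eq_abs, abs_le]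
    constructor <;> linarith [hr.1, hr.2]
  have hcont : ∀ γ : ℝ → EuclideanSpace ℝ (Fin n), IsTrajectory f x s γ →
      ContinuousOn γ (Icc s t) := fun γ hγ r hr =>
    ((hγ.2 r hr.1).continuousWithinAt).mono Icc_subset_Ici_self
  have hder : ∀ γ : ℝ → EuclideanSpace ℝ (Fin n), IsTrajectory f x s γ →
      ∀ r ∈ Ico s t, HasDerivWithinAt γ (f (γ r) r) (Ici r) r := fun γ hγ r hr =>
    (hγ.2 r hr.1).mono (Ici_subset_Ici.2 hr.1)
  have hfl := hf.isTrajectory_flow s x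
  exact ODE_solution_unique_of_mem_Icc_right (v := fun t z => f z t)
    (fun r hr => hK r (Ico_subset_Icc_self hr)) (hcont _ hy) (hder _ hy) (key _ hy)
    (hcont _ hfl) (hder _ hfl) (key _ hfl) (hy.1.trans hfl.1.symm) (right_mem_Icc.2 hst)

end Flow


/-! ### Liouville's formula for the Jacobian determinant of the flow -/

/-- Jacobi's formula for a solution of the linear matrix equation `M' = A M`. -/
lemma hasDerivWithinAt_det {ι : Type*} [Fintype ι] [DecidableEq ι] {M : ℝ → Matrix ι ι ℝ}
    {A : Matrix ι ι ℝ} {u : Set ℝ} {t : ℝ}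
    (h : ∀ i j, HasDerivWithinAt (fun r => M r i j) ((A * M t) i j) u t) :
    HasDerivWithinAt (fun r => (M r).det) (A.trace * (M t).det) u t := by
  have hdet : ∀ N : Matrix ι ι ℝ,
      N.det = ∑ σ : Equiv.Perm ι, ((Equiv.Perm.sign σ : ℤ) : ℝ) * ∏ i, N i (σ i) := fun N => by
    rw [← Matrix.det_transpose, Matrix.det_apply']
    simp
  have h1 : HasDerivWithinAt (fun r => (M r).det)
      (∑ σ : Equiv.Perm ι, ((Equiv.Perm.sign σ : ℤ) : ℝ) *
        ∑ i, (∏ j ∈ Finset.univ.erase i, M t j (σ j)) • (A * M t) i (σ i)) u t := by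
    simp_rw [hdet]
    exact HasDerivWithinAt.fun_sum fun σ _ =>
      (HasDerivWithinAt.fun_finsetProd fun i _ => h i (σ i)).const_mul _
  convert h1 using 1
  have h2 : ∀ i, ((M t).updateRow i ((A * M t) i)).det = A i i * (M t).det := fun i => by
    have : (A * M t) i = ∑ k, A i k • M t k := by
      ext j; simp [Matrix.mul_apply, Finset.sum_apply]
    rw [this, Matrix.det_updateRow_sum, smul_eq_mul]
  simp_rw [Finset.mul_sum]
  rw [Finset.sum_comm, Matrix.trace, Finset.sum_mul]
  refine Finset.sum_congr rfl fun i _ => ?_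
  rw [Matrix.diag_apply, ← h2, hdet]
  refine Finset.sum_congr rfl fun σ _ => ?_
  rw [← Finset.mul_prod_erase _ _ (Finset.mem_univ i), Matrix.updateRow_self, smul_eq_mul,
    mul_comm ((A * M t) i (σ i))]
  congr 2
  refine Finset.prod_congr rfl fun j hj => ?_
  rw [Matrix.updateRow_ne (Finset.ne_of_mem_erase hj)]

section Derivative

variable {n : ℕ} {f : EuclideanSpace ℝ (Fin n) → ℝ → EuclideanSpace ℝ (Fin n)}

/-- The linear equation `J' = A J` is solvable on intervals that are short compared to `‖A‖`. -/
lemma exists_linear_solution {E : Type*} [NormedAddCommGroup E] [NormedSpace ℝ E]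
    [CompleteSpace E] {A : ℝ → E →L[ℝ] E} (hA : Continuous A) {a b : ℝ} (hab : a ≤ b) {C : NNReal}
    (hC : ∀ t ∈ Icc a b, ‖A t‖ ≤ C) (hshort : C * (b - a) ≤ 1 / 2) :
    ∃ J : ℝ → E →L[ℝ] E, J a = 1 ∧
      ∀ t ∈ Icc a b, HasDerivWithinAt J (A t * J t) (Icc a b) t := by
  have hPL : IsPicardLindelof (fun t (J : E →L[ℝ] E) => A t * J) (tmin := a) (tmax := b)
      ⟨a, left_mem_Icc.2 hab⟩ 1 1 0 (2 * C) C := by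
    refine ⟨fun t ht => LipschitzOnWith.of_dist_le_mul fun J _ J' _ => ?_, fun J _ => ?_,
      fun t ht J hJ => ?_, ?_⟩
    · rw [dist_eq_norm, dist_eq_norm, ← mul_sub]
      refine (norm_mul_le _ _).trans ?_
      gcongr
      exact hC t ht
    · exact (by fun_prop : Continuous fun t => A t * J).continuousOn
    · rw [mem_closedBall_iff_norm] at hJ
      have h1 : ‖J‖ ≤ 2 := by
        have h2 : ‖(1 : E →L[ℝ] E)‖ ≤ 1 := ContinuousLinearMap.norm_id_le
        have h3 := norm_add_le (J - 1) 1
        rw [sub_add_cancel] at h3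
        simp only [NNReal.coe_one] at hJ
        linarith
      refine (norm_mul_le _ _).trans ?_
      push_cast
      rw [mul_comm]
      gcongr
      exact hC t ht
    · push_cast
      rw [sub_self, max_eq_left (by linarith)]
      linarith
  exact hPL.exists_eq_forall_mem_Icc_hasDerivWithinAt₀

/-- Liouville's formula. -/
lemma det_eq_exp_integral {A J : ℝ → EuclideanSpace ℝ (Fin n) →L[ℝ] EuclideanSpace ℝ (Fin n)}
    (hA : Continuous A) {a b : ℝ} (hab : a ≤ b) (h0 : J a = 1)
    (hJ : ∀ t ∈ Icc a b, HasDerivWithinAt J (A t * J t) (Icc a b) t) :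
    (J b).det =
      Real.exp (∫ t in a..b, ∑ i : Fin n, (A t (EuclideanSpace.single i 1)) i) := by
  set d : ℝ → ℝ := fun t => ∑ i : Fin n, (A t (EuclideanSpace.single i 1)) i with hd
  have hdc : Continuous d := by
    refine continuous_finsetSum _ fun i _ => ?_
    exact (EuclideanSpace.proj (𝕜 := ℝ) i).continuous.comp (hA.clm_apply continuous_const)
  let B := (EuclideanSpace.basisFun (Fin n) ℝ).toBasis
  have hdet : ∀ t ∈ Icc a b, HasDerivWithinAt (fun r => (J r).det) (d t * (J t).det)
      (Icc a b) t := by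
    intro t ht
    have := hasDerivWithinAt_det (u := Icc a b) (t := t)
      (M := fun r => LinearMap.toMatrix B B (J r).toLinearMap)
      (A := LinearMap.toMatrix B B (A t).toLinearMap) (fun i j => by
        rw [← LinearMap.toMatrix_mul]
        simp only [LinearMap.toMatrix_apply]
        have h1 := ((EuclideanSpace.proj (𝕜 := ℝ) i).hasFDerivAt.comp_hasDerivWithinAt t
          ((hJ t ht).clm_apply (hasDerivWithinAt_const t (Icc a b)
            (EuclideanSpace.single j (1 : ℝ)))))
        simpa [B, Function.comp_def] using h1)
    simp only [LinearMap.det_toMatrix] at this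
    convert this using 2
    simp [hd, Matrix.trace, LinearMap.toMatrix_apply, B]
  have hint : ∀ t, HasDerivAt (fun r => ∫ σ in a..r, d σ) (d t) t := fun t =>
    hdc.integral_hasStrictDerivAt a t |>.hasDerivAt
  have hder : ∀ t ∈ Icc a b, HasDerivWithinAt
      (fun r => (J r).det * Real.exp (-∫ σ in a..r, d σ)) 0 (Icc a b) t := by
    intro t ht
    refine ((hdet t ht).mul ((hint t).neg.exp.hasDerivWithinAt)).congr_deriv ?_
    ring
  have := constant_of_has_deriv_right_zero (fun t ht => (hder t ht).continuousWithinAt)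
    (fun t ht => (hder t (Ico_subset_Icc_self ht)).mono_of_mem_nhdsWithin
      (Icc_mem_nhdsGE_of_mem ht)) b (right_mem_Icc.2 hab)
  simp only [h0, intervalIntegral.integral_same, neg_zero, Real.exp_zero, mul_one] at this
  rw [Real.exp_neg] at this
  have h1 : (1 : EuclideanSpace ℝ (Fin n) →L[ℝ] EuclideanSpace ℝ (Fin n)).det = 1 := by
    simp [ContinuousLinearMap.det]
  rw [h1, ← div_eq_mul_inv, div_eq_one_iff_eq (Real.exp_ne_zero _)] at this
  exact this

lemma IsC1Field.continuous_fderiv_flow (hf : IsC1Field f) (s : ℝ)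
    (x : EuclideanSpace ℝ (Fin n)) :
    Continuous fun r => fderiv ℝ (fun z => f z r) (flow f s r x) :=
  hf.continuous_fderiv.comp ((hf.continuous_flow_time s x).prodMk continuous_id)

/-- The field is differentiable along a trajectory, uniformly on compact time intervals. -/
lemma IsC1Field.eventually_norm_sub_sub_le (hf : IsC1Field f) (s : ℝ)
    (x : EuclideanSpace ℝ (Fin n)) (a b : ℝ) {ε : ℝ} (hε : 0 < ε) :
    ∀ᶠ w in 𝓝 (0 : EuclideanSpace ℝ (Fin n)), ∀ r ∈ Icc a b,
      ‖f (flow f s r x + w) r - f (flow f s r x) r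
        - fderiv ℝ (fun z => f z r) (flow f s r x) w‖ ≤ ε * ‖w‖ := by
  have h1 : ∀ᶠ w in 𝓝 (0 : EuclideanSpace ℝ (Fin n)), ∀ r ∈ Icc a b,
      ‖fderiv ℝ (fun z => f z r) (flow f s r x + w)
        - fderiv ℝ (fun z => f z r) (flow f s r x)‖ < ε := by
    refine isCompact_Icc.eventually_forall_of_forall_eventually fun r _ => ?_
    have hc : Continuous fun p : EuclideanSpace ℝ (Fin n) × ℝ =>
        ‖fderiv ℝ (fun z => f z p.2) (flow f s p.2 x + p.1)
          - fderiv ℝ (fun z => f z p.2) (flow f s p.2 x)‖ := by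
      have hy := hf.continuous_flow_time s x
      refine ((hf.continuous_fderiv.comp (((hy.comp continuous_snd).add continuous_fst).prodMk
        continuous_snd)).sub ((hf.continuous_fderiv_flow s x).comp continuous_snd)).norm
    refine hc.tendsto (0, r) |>.eventually_lt_const ?_
    simpa using hε
  obtain ⟨δ, hδ, h⟩ := Metric.eventually_nhds_iff_ball.1 h1
  filter_upwards [Metric.ball_mem_nhds _ hδ] with w hw r hr
  have := (convex_ball (flow f s r x) δ).norm_image_sub_le_of_norm_hasFDerivWithin_le'
    (f := fun z => f z r) (f' := fun z => fderiv ℝ (fun z => f z r) z)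
    (φ := fderiv ℝ (fun z => f z r) (flow f s r x)) (C := ε)
    (fun z _ => (hf.differentiable r z).hasFDerivAt.hasFDerivWithinAt)
    (fun z hz => by
      have := h (z - flow f s r x) (by
        rw [mem_ball_zero_iff, ← dist_eq_norm]; exact hz) r hr
      rw [add_sub_cancel] at this
      exact this.le)
    (Metric.mem_ball_self hδ) (y := flow f s r x + w) (by simpa [mem_ball_iff_norm] using hw)
  simpa using this

/-- The solution of the linearized equation is the derivative of the flow: `y + J v` solves the
original equation up to `o(‖v‖)`, and Grönwall's inequality compares it with the trajectory that
starts from `x + v`. -/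
lemma IsC1Field.hasFDerivAt_flow_of_linear (hf : IsC1Field f) {a b : ℝ} (hab : a ≤ b)
    (x : EuclideanSpace ℝ (Fin n))
    {J : ℝ → EuclideanSpace ℝ (Fin n) →L[ℝ] EuclideanSpace ℝ (Fin n)} (h0 : J a = 1)
    (hJ : ∀ t ∈ Icc a b, HasDerivWithinAt J
      (fderiv ℝ (fun z => f z t) (flow f a t x) * J t) (Icc a b) t) :
    HasFDerivAt (flow f a b) (J b) x := by
  obtain ⟨M, hM⟩ := hf.exists_speed
  have hJc : ContinuousOn J (Icc a b) := fun t ht => (hJ t ht).continuousWithinAt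
  obtain ⟨CJ, hCJ⟩ := isCompact_Icc.exists_bound_of_continuousOn hJc
  have hCJ0 : 0 ≤ CJ := (norm_nonneg _).trans (hCJ a (left_mem_Icc.2 hab))
  set R : ℝ := 1 + M * (b - a) with hR
  obtain ⟨K', hK'⟩ := hf.exists_lipschitzOnWith x R a b
  obtain ⟨K, hK0, hK⟩ : ∃ K : NNReal, (K : ℝ) ≠ 0 ∧ ∀ t ∈ Icc a b,
      LipschitzOnWith K (fun z => f z t) (Metric.closedBall x R) :=
    ⟨K' + 1, by positivity, fun t ht => (hK' t ht).weaken (by simp)⟩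
  set G : ℝ := 1 / K * (Real.exp (K * (b - a)) - 1) with hG
  have hG0 : 0 ≤ G := by
    have : 0 ≤ (K : ℝ) * (b - a) := mul_nonneg K.2 (by linarith)
    have := Real.add_one_le_exp (K * (b - a))
    rw [hG]
    apply mul_nonneg (by positivity)
    linarith
  rw [hasFDerivAt_iff_isLittleO_nhds_zero, Asymptotics.isLittleO_iff]
  intro c hc
  set ε : ℝ := c / (CJ * G + 1) with hεdef
  have hε : 0 < ε := by positivity
  obtain ⟨δ, hδ, hdiff⟩ := Metric.eventually_nhds_iff_ball.1
    (hf.eventually_norm_sub_sub_le a x a b hε)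
  have hev : ∀ᶠ v in 𝓝 (0 : EuclideanSpace ℝ (Fin n)), ‖v‖ < 1 ∧ CJ * ‖v‖ < 1 ∧ CJ * ‖v‖ < δ := by
    have hc1 : Tendsto (fun v : EuclideanSpace ℝ (Fin n) => ‖v‖) (𝓝 0) (𝓝 0) := by
      simpa using (continuous_norm.tendsto (0 : EuclideanSpace ℝ (Fin n)))
    have hc2 : Tendsto (fun v : EuclideanSpace ℝ (Fin n) => CJ * ‖v‖) (𝓝 0) (𝓝 0) := by
      simpa using hc1.const_mul CJ
    exact (hc1.eventually_lt_const one_pos).and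
      ((hc2.eventually_lt_const one_pos).and (hc2.eventually_lt_const hδ))
  filter_upwards [hev] with v ⟨hv1, hv2, hv3⟩
  have hJv : ∀ t ∈ Icc a b, ‖J t v‖ ≤ CJ * ‖v‖ := fun t ht =>
    (J t).le_of_opNorm_le (hCJ t ht) v
  have hmove : ∀ z, ∀ t ∈ Icc a b, ‖flow f a t z - z‖ ≤ M * (b - a) := fun z t ht => by
    refine (hf.norm_flow_sub_le hM a t z).trans ?_
    gcongr
    rw [abs_of_nonneg (by linarith [ht.1])]
    linarith [ht.2]
  have hgw := dist_le_of_approx_trajectories_ODE_of_mem (a := a) (b := b) (K := K)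
    (v := fun t z => f z t) (s := fun _ => Metric.closedBall x R)
    (f := fun t => flow f a t (x + v)) (g := fun t => flow f a t x + J t v)
    (f' := fun t => f (flow f a t (x + v)) t)
    (g' := fun t => f (flow f a t x) t + fderiv ℝ (fun z => f z t) (flow f a t x) (J t v))
    (εf := 0) (εg := ε * (CJ * ‖v‖)) (δ := 0)
    (fun t ht => hK t (Ico_subset_Icc_self ht))
    (hf.continuous_flow_time a (x + v)).continuousOn
    (fun t _ => (hf.hasDerivAt_flow a (x + v) t).hasDerivWithinAt)
    (fun t _ => by simp)
    (fun t ht => by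
      rw [mem_closedBall_iff_norm]
      have h1 := norm_add_le (flow f a t (x + v) - (x + v)) v
      have h2 := hmove (x + v) t (Ico_subset_Icc_self ht)
      have h3 : flow f a t (x + v) - (x + v) + v = flow f a t (x + v) - x := by abel
      rw [h3] at h1
      linarith)
    ((hf.continuous_flow_time a x).continuousOn.add (hJc.clm_apply continuousOn_const))
    (fun t ht => by
      have h1 := (hJ t (Ico_subset_Icc_self ht)).mono_of_mem_nhdsWithin
        (Icc_mem_nhdsGE_of_mem ht)
      have h2 := h1.clm_apply (hasDerivWithinAt_const t (Ici t) v)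
      simp only [map_zero, add_zero] at h2
      exact (hf.hasDerivAt_flow a x t).hasDerivWithinAt.add h2)
    (fun t ht => by
      have h1 := hJv t (Ico_subset_Icc_self ht)
      have h2 := hdiff (J t v) (by rw [mem_ball_zero_iff]; exact h1.trans_lt hv3) t
        (Ico_subset_Icc_self ht)
      rw [dist_comm, dist_eq_norm, ← sub_sub]
      exact h2.trans (by gcongr))
    (fun t ht => by
      rw [mem_closedBall_iff_norm]
      have h1 := hJv t (Ico_subset_Icc_self ht)
      have h2 := hmove x t (Ico_subset_Icc_self ht)
      have h3 := norm_add_le (flow f a t x - x) (J t v)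
      have h4 : flow f a t x - x + J t v = flow f a t x + J t v - x := by abel
      rw [h4] at h3
      linarith)
    (by simp [hf.flow_self, h0]) b (right_mem_Icc.2 hab)
  rw [gronwallBound_of_K_ne_0 hK0, dist_eq_norm] at hgw
  rw [sub_sub]
  beta_reduce at hgw
  refine hgw.trans ?_
  have : 0 * Real.exp (K * (b - a)) + (0 + ε * (CJ * ‖v‖)) / K * (Real.exp (K * (b - a)) - 1)
      = ε * (CJ * G) * ‖v‖ := by rw [hG]; ring
  rw [this]
  gcongr
  rw [hεdef, div_mul_eq_mul_div, div_le_iff₀ (by positivity)]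
  gcongr
  linarith

/-- The flow is differentiable in the starting point, and its Jacobian determinant is the
exponential of the integral of the divergence along the trajectory. -/
theorem IsC1Field.exists_hasFDerivAt_flow (hf : IsC1Field f) {a b : ℝ} (hab : a ≤ b)
    (x : EuclideanSpace ℝ (Fin n)) :
    ∃ J : EuclideanSpace ℝ (Fin n) →L[ℝ] EuclideanSpace ℝ (Fin n),
      HasFDerivAt (flow f a b) J x ∧
        J.det = Real.exp (∫ t in a..b, divergence f (flow f a t x) t) := by
  obtain ⟨C', hC'⟩ := isCompact_Icc.exists_bound_of_continuousOn (s := Icc a b)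
    (hf.continuous_fderiv_flow a x).continuousOn
  set C : NNReal := C'.toNNReal
  have hC : ∀ t ∈ Icc a b, ‖fderiv ℝ (fun z => f z t) (flow f a t x)‖ ≤ C := fun t ht =>
    (hC' t ht).trans (Real.le_coe_toNNReal C')
  have hdiv : Continuous fun t => divergence f (flow f a t x) t := by
    refine continuous_finsetSum _ fun i _ => ?_
    exact (EuclideanSpace.proj (𝕜 := ℝ) i).continuous.comp
      ((hf.continuous_fderiv_flow a x).clm_apply continuous_const)
  -- the linearized equation is solved on intervals of length at most `h`, and the derivatives of
  -- the flow over consecutive intervals are composed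
  set h : ℝ := 1 / (2 * (C + 1)) with hh
  have hpos : 0 < h := by positivity
  have key : ∀ k : ℕ, ∀ t ∈ Icc a b, t ≤ a + k * h →
      ∃ J : EuclideanSpace ℝ (Fin n) →L[ℝ] EuclideanSpace ℝ (Fin n),
      HasFDerivAt (flow f a t) J x ∧
        J.det = Real.exp (∫ r in a..t, divergence f (flow f a r x) r) := by
    intro k
    induction k with
    | zero =>
      intro t ht hk
      have : t = a := le_antisymm (by simpa using hk) ht.1
      subst this
      refine ⟨1, ?_, by simp [ContinuousLinearMap.det]⟩
      have : flow f t t = id := funext fun z => hf.flow_self t z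
      rw [this]
      exact hasFDerivAt_id x
    | succ k ih =>
      intro t ht hk
      have hr : max a (t - h) ∈ Icc a t := ⟨le_max_left _ _, max_le ht.1 (by linarith)⟩
      have hth : t - h ≤ max a (t - h) := le_max_right _ _
      obtain ⟨J₁, hJ₁, hd₁⟩ := ih (max a (t - h)) ⟨hr.1, hr.2.trans ht.2⟩
        (max_le (by simp; positivity) (by push_cast at hk; linarith))
      generalize max a (t - h) = r at hr hth hJ₁ hd₁
      set A : ℝ → EuclideanSpace ℝ (Fin n) →L[ℝ] EuclideanSpace ℝ (Fin n) := fun σ =>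
        fderiv ℝ (fun z => f z σ) (flow f r σ (flow f a r x)) with hAdef
      have hA : A = fun σ => fderiv ℝ (fun z => f z σ) (flow f a σ x) := by
        funext σ; rw [hAdef, ← hf.flow_flow a r σ x]
      have hAc : Continuous A := hA ▸ hf.continuous_fderiv_flow a x
      obtain ⟨J, hJ0, hJ⟩ := exists_linear_solution hAc hr.2 (C := C)
        (fun σ hσ => by rw [hA]; exact hC σ ⟨hr.1.trans hσ.1, hσ.2.trans ht.2⟩) (by
          have : (C : ℝ) * (t - r) ≤ C * h := by gcongr; linarith
          refine this.trans ?_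
          rw [hh, mul_one_div, div_le_div_iff₀ (by positivity) (by norm_num)]
          linarith [C.2])
      have hder := hf.hasFDerivAt_flow_of_linear hr.2 (flow f a r x) hJ0 hJ
      refine ⟨J t * J₁, ?_, ?_⟩
      · have hcomp : flow f a t = flow f r t ∘ flow f a r :=
          funext fun z => (hf.flow_flow a r t z).symm
        rw [hcomp]
        exact hder.comp x hJ₁
      · have hd₂ := det_eq_exp_integral hAc hr.2 hJ0 hJ
        have : (J t * J₁).det = (J t).det * J₁.det := by
          simp only [ContinuousLinearMap.det, ContinuousLinearMap.toLinearMap_mul, map_mul]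
        rw [this, hd₁, hd₂, hA, ← Real.exp_add, add_comm]
        congr 1
        exact intervalIntegral.integral_add_adjacent_intervals
          (hdiv.intervalIntegrable _ _) (hdiv.intervalIntegrable _ _)
  obtain ⟨k, hk⟩ := exists_nat_ge ((b - a) / h)
  refine key k b (right_mem_Icc.2 hab) ?_
  rw [div_le_iff₀ hpos] at hk
  linarith

end Derivative


/-! ### Points whose trajectory stays in the domain -/

section Survival

variable {n : ℕ} {f : EuclideanSpace ℝ (Fin n) → ℝ → EuclideanSpace ℝ (Fin n)}
  {D : Set (EuclideanSpace ℝ (Fin n))}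

/-- The points `x` whose trajectory through `(x, s)` stays in `D` between the times `s` and `t`.
The times may come in either order, so that `Φ_{s,t}` maps `survivalSet f D s t` onto
`survivalSet f D t s`. -/
def survivalSet (f : EuclideanSpace ℝ (Fin n) → ℝ → EuclideanSpace ℝ (Fin n))
    (D : Set (EuclideanSpace ℝ (Fin n))) (s t : ℝ) : Set (EuclideanSpace ℝ (Fin n)) :=
  {x | ∀ r ∈ uIcc s t, flow f s r x ∈ D}

lemma IsC1Field.survivalSet_subset (hf : IsC1Field f) (s t : ℝ) : survivalSet f D s t ⊆ D :=
  fun x hx => hf.flow_self s x ▸ hx s left_mem_uIcc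

lemma IsC1Field.isOpen_survivalSet_prod (hf : IsC1Field f) (hD : IsOpen D) (s : ℝ) :
    IsOpen {p : ℝ × EuclideanSpace ℝ (Fin n) | p.2 ∈ survivalSet f D s p.1} := by
  -- parametrize the time interval by `[0, 1]` to have a fixed compact set of parameters
  have h : ∀ p : ℝ × EuclideanSpace ℝ (Fin n), p.2 ∈ survivalSet f D s p.1 ↔
      ∀ θ ∈ Icc (0 : ℝ) 1, flow f s (s + θ * (p.1 - s)) p.2 ∈ D := by
    intro p
    have : uIcc s p.1 = (fun θ : ℝ => s + θ * (p.1 - s)) '' Icc (0 : ℝ) 1 := by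
      rw [← segment_eq_uIcc, segment_eq_image']
      rfl
    rw [survivalSet, mem_ofPred_eq, this, forall_mem_image]
  rw [isOpen_iff_eventually]
  intro p hp
  rw [mem_ofPred_eq, h] at hp
  simp_rw [mem_ofPred_eq, h]
  refine isCompact_Icc.eventually_forall_of_forall_eventually fun θ hθ => ?_
  have hc : Continuous fun q : (ℝ × EuclideanSpace ℝ (Fin n)) × ℝ =>
      flow f s (s + q.2 * (q.1.1 - s)) q.1.2 :=
    (hf.continuous_flow s).comp (by fun_prop :
      Continuous fun q : (ℝ × EuclideanSpace ℝ (Fin n)) × ℝ => (s + q.2 * (q.1.1 - s), q.1.2))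
  exact hc.continuousAt.eventually (hD.mem_nhds (hp θ hθ))

lemma IsC1Field.isOpen_survivalSet (hf : IsC1Field f) (hD : IsOpen D) (s t : ℝ) :
    IsOpen (survivalSet f D s t) :=
  (hf.isOpen_survivalSet_prod hD s).preimage (by fun_prop : Continuous fun x => (t, x))

lemma IsC1Field.flow_mem_survivalSet_iff (hf : IsC1Field f) {s t : ℝ}
    {x : EuclideanSpace ℝ (Fin n)} :
    flow f s t x ∈ survivalSet f D t s ↔ x ∈ survivalSet f D s t := by
  simp only [survivalSet, mem_ofPred_eq, hf.flow_flow, uIcc_comm t s]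

lemma IsC1Field.image_survivalSet (hf : IsC1Field f) (s t : ℝ) :
    flow f s t '' survivalSet f D s t = survivalSet f D t s := by
  ext z
  constructor
  · rintro ⟨x, hx, rfl⟩
    exact hf.flow_mem_survivalSet_iff.2 hx
  · intro hz
    exact ⟨flow f t s z, hf.flow_mem_survivalSet_iff.2 hz, hf.flow_flow_self t s z⟩

lemma IsC1Field.mem_survivalSet_iff_of_le (hf : IsC1Field f) {s r t : ℝ} (hsr : s ≤ r)
    (hrt : r ≤ t) {x : EuclideanSpace ℝ (Fin n)} :
    x ∈ survivalSet f D s t ↔ x ∈ survivalSet f D s r ∧ flow f s r x ∈ survivalSet f D r t := by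
  simp only [survivalSet, mem_ofPred_eq, hf.flow_flow, uIcc_of_le hsr, uIcc_of_le hrt,
    uIcc_of_le (hsr.trans hrt), ← Icc_union_Icc_eq_Icc hsr hrt, mem_union, or_imp, forall_and]

/-- A trajectory starting in `D` stays in `D` for a time that does not depend on the initial
time. -/
lemma IsC1Field.exists_mem_survivalSet (hf : IsC1Field f) (hD : IsOpen D)
    {x : EuclideanSpace ℝ (Fin n)} (hx : x ∈ D) :
    ∃ δ > 0, ∀ s t : ℝ, |t - s| < δ → x ∈ survivalSet f D s t := by
  obtain ⟨M, hM⟩ := hf.exists_speed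
  obtain ⟨ε, hε, hball⟩ := Metric.isOpen_iff.1 hD x hx
  refine ⟨ε / (M + 1), by positivity, fun s t hst r hr => hball ?_⟩
  rw [mem_ball_iff_norm]
  have h1 : |r - s| ≤ |t - s| := abs_sub_left_of_mem_uIcc hr
  rw [lt_div_iff₀ (by positivity)] at hst
  have h2 := hf.norm_flow_sub_le hM s r x
  nlinarith [M.2, abs_nonneg (t - s), abs_nonneg (r - s)]

end Survival

/-! ### Change of variables along the flow -/

section Transport

variable {n : ℕ} {f : EuclideanSpace ℝ (Fin n) → ℝ → EuclideanSpace ℝ (Fin n)}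
  {D : Set (EuclideanSpace ℝ (Fin n))}

/-- `sup_{x ∈ D} |div f(x, t)|`. -/
noncomputable def supDivergence
    (f : EuclideanSpace ℝ (Fin n) → ℝ → EuclideanSpace ℝ (Fin n))
    (D : Set (EuclideanSpace ℝ (Fin n))) (t : ℝ) : ℝ :=
  ⨆ x : D, |divergence f x t|

lemma IsC1Field.continuous_divergence (hf : IsC1Field f) :
    Continuous fun p : EuclideanSpace ℝ (Fin n) × ℝ => divergence f p.1 p.2 := by
  refine continuous_finsetSum _ fun i _ => ?_
  exact (EuclideanSpace.proj (𝕜 := ℝ) i).continuous.comp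
    (hf.continuous_fderiv.clm_apply continuous_const)

lemma IsC1Field.exists_abs_divergence_le (hf : IsC1Field f) (hD : Bornology.IsBounded D)
    (a b : ℝ) : ∃ C : ℝ, 0 ≤ C ∧ ∀ x ∈ D, ∀ t ∈ Icc a b, |divergence f x t| ≤ C := by
  obtain ⟨C, hC⟩ := (hD.isCompact_closure.prod (isCompact_Icc (a := a) (b := b))
    ).exists_bound_of_continuousOn hf.continuous_divergence.continuousOn
  exact ⟨max C 0, le_max_right _ _, fun x hx t ht =>
    (hC (x, t) ⟨subset_closure hx, ht⟩).trans (le_max_left _ _)⟩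

lemma supDivergence_nonneg (t : ℝ) : 0 ≤ supDivergence f D t :=
  Real.iSup_nonneg fun _ => abs_nonneg _

lemma IsC1Field.bddAbove_abs_divergence (hf : IsC1Field f) (hD : Bornology.IsBounded D) (t : ℝ) :
    BddAbove (range fun x : D => |divergence f x t|) := by
  obtain ⟨C, -, hC⟩ := hf.exists_abs_divergence_le hD t t
  exact ⟨C, by rintro _ ⟨x, rfl⟩; exact hC x x.2 t (by simp)⟩

lemma IsC1Field.abs_divergence_le_supDivergence (hf : IsC1Field f) (hD : Bornology.IsBounded D)
    {x : EuclideanSpace ℝ (Fin n)} (hx : x ∈ D) (t : ℝ) :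
    |divergence f x t| ≤ supDivergence f D t :=
  le_ciSup (hf.bddAbove_abs_divergence hD t) (⟨x, hx⟩ : D)

lemma IsC1Field.exists_supDivergence_le (hf : IsC1Field f) (hD : Bornology.IsBounded D)
    (a b : ℝ) : ∃ C : ℝ, 0 ≤ C ∧ ∀ t ∈ Icc a b, supDivergence f D t ≤ C := by
  obtain ⟨C, hC0, hC⟩ := hf.exists_abs_divergence_le hD a b
  exact ⟨C, hC0, fun t ht => Real.iSup_le (fun x => hC x x.2 t ht) hC0⟩

lemma IsC1Field.intervalIntegrable_supDivergence (hf : IsC1Field f)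
    (hD : Bornology.IsBounded D) (a b : ℝ) :
    IntervalIntegrable (supDivergence f D) volume a b := by
  have hm : Measurable (supDivergence f D) := by
    refine LowerSemicontinuous.measurable (lowerSemicontinuous_ciSup
      (fun t => hf.bddAbove_abs_divergence hD t) fun x => Continuous.lowerSemicontinuous ?_)
    exact (hf.continuous_divergence.comp
      (by fun_prop : Continuous fun t : ℝ => ((x : EuclideanSpace ℝ (Fin n)), t))).abs
  obtain ⟨C, -, hC⟩ := hf.exists_supDivergence_le hD (min a b) (max a b)
  rw [intervalIntegrable_iff]
  refine Measure.integrableOn_of_bounded (M := C) (by simp) hm.aestronglyMeasurable ?_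
  refine (ae_restrict_iff' measurableSet_uIoc).2 (Eventually.of_forall fun t ht => ?_)
  rw [Real.norm_eq_abs, abs_of_nonneg (supDivergence_nonneg t)]
  exact hC t (uIoc_subset_uIcc ht)

lemma IsC1Field.abs_integral_supDivergence_le (hf : IsC1Field f) (hD : Bornology.IsBounded D)
    {T s t : ℝ} (hs : s ∈ Icc 0 T) (ht : t ∈ Icc 0 T) :
    |∫ r in s..t, supDivergence f D r| ≤ ∫ r in 0..T, supDivergence f D r := by
  have h := intervalIntegral.abs_integral_mono_interval (f := supDivergence f D) (a := s) (b := t)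
    (c := 0) (d := T) (μ := volume) ?_ (Eventually.of_forall supDivergence_nonneg)
    (hf.intervalIntegrable_supDivergence hD _ _)
  · refine h.trans_eq (abs_of_nonneg ?_)
    exact intervalIntegral.integral_nonneg (hs.1.trans hs.2) fun r _ => supDivergence_nonneg r
  · refine uIoc_subset_uIoc_of_uIcc_subset_uIcc (uIcc_subset_uIcc ?_ ?_)
    · rwa [uIcc_of_le (hs.1.trans hs.2)]
    · rwa [uIcc_of_le (hs.1.trans hs.2)]

lemma IsC1Field.hasFDerivAt_flow (hf : IsC1Field f) {a b : ℝ} (hab : a ≤ b)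
    (x : EuclideanSpace ℝ (Fin n)) :
    HasFDerivAt (flow f a b) (fderiv ℝ (flow f a b) x) x := by
  obtain ⟨J, hJ, -⟩ := hf.exists_hasFDerivAt_flow hab x
  exact hJ.differentiableAt.hasFDerivAt

lemma IsC1Field.abs_det_fderiv_flow (hf : IsC1Field f) {a b : ℝ} (hab : a ≤ b)
    (x : EuclideanSpace ℝ (Fin n)) :
    |(fderiv ℝ (flow f a b) x).det| = Real.exp (∫ t in a..b, divergence f (flow f a t x) t) := by
  obtain ⟨J, hJ, hd⟩ := hf.exists_hasFDerivAt_flow hab x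
  rw [hJ.fderiv, hd, abs_of_pos (Real.exp_pos _)]

lemma IsC1Field.abs_integral_divergence_le (hf : IsC1Field f) (hD : Bornology.IsBounded D)
    {a b : ℝ} (hab : a ≤ b) {x : EuclideanSpace ℝ (Fin n)} (hx : x ∈ survivalSet f D a b) :
    |∫ t in a..b, divergence f (flow f a t x) t| ≤ ∫ t in a..b, supDivergence f D t := by
  rw [← Real.norm_eq_abs]
  refine intervalIntegral.norm_integral_le_of_norm_le hab (Eventually.of_forall fun t ht => ?_)
    (hf.intervalIntegrable_supDivergence hD a b)
  refine hf.abs_divergence_le_supDivergence hD (hx t ?_) t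
  rw [uIcc_of_le hab]
  exact Ioc_subset_Icc_self ht

lemma IsC1Field.injective_flow (hf : IsC1Field f) (s t : ℝ) : Function.Injective (flow f s t) :=
  Function.LeftInverse.injective (hf.flow_flow_self s t)

lemma IsC1Field.lintegral_survivalSet (hf : IsC1Field f) (hDo : IsOpen D) {a b : ℝ}
    (hab : a ≤ b) (g : EuclideanSpace ℝ (Fin n) → ℝ≥0∞) :
    ∫⁻ z in survivalSet f D b a, g z = ∫⁻ x in survivalSet f D a b,
      ENNReal.ofReal |(fderiv ℝ (flow f a b) x).det| * g (flow f a b x) := by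
  rw [← hf.image_survivalSet a b]
  exact lintegral_image_eq_lintegral_abs_det_fderiv_mul _
    (hf.isOpen_survivalSet hDo a b).measurableSet
    (fun x _ => (hf.hasFDerivAt_flow hab x).hasFDerivWithinAt) (hf.injective_flow a b).injOn g

lemma IsC1Field.lintegral_comp_flow_le (hf : IsC1Field f) (hDo : IsOpen D)
    (hDb : Bornology.IsBounded D) (s t : ℝ) (g : EuclideanSpace ℝ (Fin n) → ℝ≥0∞) :
    ∫⁻ x in survivalSet f D s t, g (flow f s t x) ≤
      ENNReal.ofReal (Real.exp |∫ r in s..t, supDivergence f D r|) *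
        ∫⁻ z in survivalSet f D t s, g z := by
  have hpos : ∀ {a b : ℝ}, a ≤ b → 0 ≤ ∫ r in a..b, supDivergence f D r := fun hab =>
    intervalIntegral.integral_nonneg hab fun r _ => supDivergence_nonneg r
  rcases le_total s t with hst | hts
  · rw [hf.lintegral_survivalSet hDo hst, ← lintegral_const_mul' _ _ ENNReal.ofReal_ne_top]
    refine setLIntegral_mono' (hf.isOpen_survivalSet hDo s t).measurableSet fun x hx => ?_
    rw [← mul_assoc, ← ENNReal.ofReal_mul (Real.exp_pos _).le, hf.abs_det_fderiv_flow hst,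
      ← Real.exp_add]
    refine le_mul_of_one_le_left (by simp) ?_
    rw [← ENNReal.ofReal_one]
    refine ENNReal.ofReal_le_ofReal (Real.one_le_exp ?_)
    have h1 := (abs_le.1 (hf.abs_integral_divergence_le hDb hst hx)).1
    have h2 := le_abs_self (∫ r in s..t, supDivergence f D r)
    linarith
  · rw [hf.lintegral_survivalSet hDo hts, ← lintegral_const_mul' _ _ ENNReal.ofReal_ne_top]
    refine setLIntegral_mono' (hf.isOpen_survivalSet hDo t s).measurableSet fun x hx => ?_
    rw [hf.flow_flow_self, hf.abs_det_fderiv_flow hts]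
    gcongr
    rw [intervalIntegral.integral_symm t s, abs_neg, abs_of_nonneg (hpos hts)]
    exact (abs_le.1 (hf.abs_integral_divergence_le hDb hts hx)).2

lemma IsC1Field.continuous_flow_space (hf : IsC1Field f) (s t : ℝ) : Continuous (flow f s t) :=
  (hf.continuous_flow s).comp (by fun_prop : Continuous fun x => (t, x))

/-- The flow compresses volume by at most the square of the growth constant, as long as it stays
in `D`. -/
lemma IsC1Field.map_flow_le (hf : IsC1Field f) (hDo : IsOpen D) (hDb : Bornology.IsBounded D)
    {T s t : ℝ} (hs : s ∈ Icc 0 T) (ht : t ∈ Icc 0 T) :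
    (volume.restrict (survivalSet f D s t)).map (flow f s t) ≤
      ENNReal.ofReal (growthConstant f D T ^ 2) • volume.restrict D := by
  have hm := (hf.continuous_flow_space s t).measurable
  refine Measure.le_iff.2 fun B hB => ?_
  rw [← lintegral_indicator_one hB, lintegral_map (measurable_one.indicator hB) hm]
  refine (hf.lintegral_comp_flow_le hDo hDb s t _).trans ?_
  rw [Measure.smul_apply, smul_eq_mul, ← lintegral_indicator_one hB]
  gcongr
  · rw [growthConstant, ← Real.exp_nat_mul]
    refine Real.exp_le_exp.2 ((hf.abs_integral_supDivergence_le hDb hs ht).trans_eq ?_)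
    push_cast
    rw [← mul_assoc, mul_one_div_cancel two_ne_zero, one_mul]
    rfl
  · exact hf.survivalSet_subset t s

/-- The operator `g ↦ g ∘ Φ_{s,t}` on functions on `D`, where the value is `0` at the points whose
trajectory leaves `D` between the times `s` and `t`. -/
noncomputable def transport (f : EuclideanSpace ℝ (Fin n) → ℝ → EuclideanSpace ℝ (Fin n))
    (D : Set (EuclideanSpace ℝ (Fin n))) (s t : ℝ) (g : EuclideanSpace ℝ (Fin n) → ℝ) :
    EuclideanSpace ℝ (Fin n) → ℝ :=
  (survivalSet f D s t).indicator fun x => g (flow f s t x)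

lemma growthConstant_pos (T : ℝ) : 0 < growthConstant f D T := Real.exp_pos _

lemma IsC1Field.restrict_survivalSet (hf : IsC1Field f) (hDo : IsOpen D) (s t : ℝ) :
    (volume.restrict D).restrict (survivalSet f D s t) =
      volume.restrict (survivalSet f D s t) := by
  rw [Measure.restrict_restrict (hf.isOpen_survivalSet hDo s t).measurableSet,
    inter_eq_left.2 (hf.survivalSet_subset s t)]

section

variable {T s t : ℝ}

lemma IsC1Field.absolutelyContinuous_map_flow (hf : IsC1Field f) (hDo : IsOpen D)
    (hDb : Bornology.IsBounded D) (hs : s ∈ Icc 0 T) (ht : t ∈ Icc 0 T) :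
    (volume.restrict (survivalSet f D s t)).map (flow f s t) ≪ volume.restrict D :=
  (Measure.absolutelyContinuous_of_le (hf.map_flow_le hDo hDb hs ht)).trans
    Measure.smul_absolutelyContinuous

lemma IsC1Field.aestronglyMeasurable_comp_flow (hf : IsC1Field f) (hDo : IsOpen D)
    (hDb : Bornology.IsBounded D) (hs : s ∈ Icc 0 T) (ht : t ∈ Icc 0 T)
    {g : EuclideanSpace ℝ (Fin n) → ℝ} (hg : AEStronglyMeasurable g (volume.restrict D)) :
    AEStronglyMeasurable (fun x => g (flow f s t x))
      (volume.restrict (survivalSet f D s t)) :=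
  (hg.mono_ac (hf.absolutelyContinuous_map_flow hDo hDb hs ht)).comp_measurable
    (hf.continuous_flow_space s t).measurable

lemma IsC1Field.aestronglyMeasurable_transport (hf : IsC1Field f) (hDo : IsOpen D)
    (hDb : Bornology.IsBounded D) (hs : s ∈ Icc 0 T) (ht : t ∈ Icc 0 T)
    {g : EuclideanSpace ℝ (Fin n) → ℝ} (hg : AEStronglyMeasurable g (volume.restrict D)) :
    AEStronglyMeasurable (transport f D s t g) (volume.restrict D) := by
  rw [transport, aestronglyMeasurable_indicator_iff (hf.isOpen_survivalSet hDo s t).measurableSet,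
    hf.restrict_survivalSet hDo]
  exact hf.aestronglyMeasurable_comp_flow hDo hDb hs ht hg

lemma IsC1Field.eLpNorm_transport_le (hf : IsC1Field f) (hDo : IsOpen D)
    (hDb : Bornology.IsBounded D) (hs : s ∈ Icc 0 T) (ht : t ∈ Icc 0 T)
    {g : EuclideanSpace ℝ (Fin n) → ℝ} (hg : AEStronglyMeasurable g (volume.restrict D)) :
    eLpNorm (transport f D s t g) 2 (volume.restrict D) ≤
      ENNReal.ofReal (growthConstant f D T) * eLpNorm g 2 (volume.restrict D) := by
  rw [transport, eLpNorm_indicator_eq_eLpNorm_restrict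
    (hf.isOpen_survivalSet hDo s t).measurableSet, hf.restrict_survivalSet hDo]
  have h1 := eLpNorm_map_measure (p := 2)
    (hg.mono_ac (hf.absolutelyContinuous_map_flow hDo hDb hs ht))
    (hf.continuous_flow_space s t).aemeasurable
  change eLpNorm (g ∘ flow f s t) 2 _ ≤ _
  rw [← h1]
  refine (eLpNorm_mono_measure _ (hf.map_flow_le hDo hDb hs ht)).trans ?_
  rw [eLpNorm_smul_measure_of_ne_top (by simp), smul_eq_mul,
    ENNReal.ofReal_rpow_of_nonneg (by positivity) (by positivity), ← Real.rpow_natCast,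
    ← Real.rpow_mul (growthConstant_pos T).le]
  norm_num

lemma IsC1Field.memLp_transport (hf : IsC1Field f) (hDo : IsOpen D)
    (hDb : Bornology.IsBounded D) (hs : s ∈ Icc 0 T) (ht : t ∈ Icc 0 T)
    {g : EuclideanSpace ℝ (Fin n) → ℝ} (hg : MemLp g 2 (volume.restrict D)) :
    MemLp (transport f D s t g) 2 (volume.restrict D) :=
  ⟨hf.aestronglyMeasurable_transport hDo hDb hs ht hg.1,
    (hf.eLpNorm_transport_le hDo hDb hs ht hg.1).trans_lt
      (ENNReal.mul_lt_top ENNReal.ofReal_lt_top hg.2)⟩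

end

lemma transport_sub (s t : ℝ) (g h : EuclideanSpace ℝ (Fin n) → ℝ) :
    transport f D s t (g - h) = transport f D s t g - transport f D s t h := by
  ext x
  by_cases hx : x ∈ survivalSet f D s t <;> simp [transport, hx]

end Transport


/-! ### Strong and weak continuity of the transport operators -/

section Continuity

variable {n : ℕ} {f : EuclideanSpace ℝ (Fin n) → ℝ → EuclideanSpace ℝ (Fin n)}
  {D : Set (EuclideanSpace ℝ (Fin n))} {T : ℝ}

lemma lintegral_enorm_mul_le {α : Type*} [MeasurableSpace α] {μ : Measure α} {u v : α → ℝ}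
    (hu : AEStronglyMeasurable u μ) (hv : AEStronglyMeasurable v μ) :
    ∫⁻ x, ‖u x * v x‖ₑ ∂μ ≤ eLpNorm u 2 μ * eLpNorm v 2 μ := by
  have := eLpNorm_smul_le_mul_eLpNorm (p := 2) (q := 2) (r := 1) hv hu
  rwa [eLpNorm_one_eq_lintegral_enorm] at this

lemma enorm_integral_mul_le {α : Type*} [MeasurableSpace α] {μ : Measure α} {u v : α → ℝ}
    (hu : AEStronglyMeasurable u μ) (hv : AEStronglyMeasurable v μ) :
    ‖∫ x, u x * v x ∂μ‖ₑ ≤ eLpNorm u 2 μ * eLpNorm v 2 μ :=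
  (enorm_integral_le_lintegral_enorm _).trans (lintegral_enorm_mul_le hu hv)

lemma integrable_fun_mul {α : Type*} [MeasurableSpace α] {μ : Measure α} {u v : α → ℝ}
    (hu : MemLp u 2 μ) (hv : MemLp v 2 μ) : Integrable (fun x => u x * v x) μ :=
  hu.integrable_mul hv

/-- The filter of pairs `(s, t)` of times in `[0, T]` with `t - s → 0`. -/
def closeTimes (T : ℝ) : Filter (ℝ × ℝ) :=
  comap (fun p : ℝ × ℝ => p.2 - p.1) (𝓝 0) ⊓ 𝓟 (Icc 0 T ×ˢ Icc 0 T)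

instance : (closeTimes T).IsCountablyGenerated := by
  unfold closeTimes; infer_instance

lemma tendsto_sub_closeTimes :
    Tendsto (fun p : ℝ × ℝ => p.2 - p.1) (closeTimes T) (𝓝 0) :=
  tendsto_comap.mono_left inf_le_left

lemma eventually_mem_closeTimes : ∀ᶠ p in closeTimes T, p.1 ∈ Icc 0 T ∧ p.2 ∈ Icc 0 T :=
  mem_inf_of_right (mem_principal_self _)

lemma tendsto_closeTimes {ι : Type*} {l : Filter ι} {a b : ι → ℝ}
    (h : Tendsto (fun i => b i - a i) l (𝓝 0)) (ha : ∀ᶠ i in l, a i ∈ Icc 0 T)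
    (hb : ∀ᶠ i in l, b i ∈ Icc 0 T) : Tendsto (fun i => (a i, b i)) l (closeTimes T) :=
  tendsto_inf.2 ⟨tendsto_comap_iff.2 h, tendsto_principal.2 (ha.and hb)⟩

lemma tendsto_swap_closeTimes : Tendsto Prod.swap (closeTimes T) (closeTimes T) :=
  tendsto_closeTimes (a := fun p : ℝ × ℝ => p.2) (b := fun p : ℝ × ℝ => p.1)
    (by simpa using (tendsto_sub_closeTimes (T := T)).neg)
    (eventually_mem_closeTimes.mono fun _ h => h.2)
    (eventually_mem_closeTimes.mono fun _ h => h.1)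

lemma IsC1Field.tendsto_transport_apply (hf : IsC1Field f) (hDo : IsOpen D)
    {g : EuclideanSpace ℝ (Fin n) → ℝ} (hg : Continuous g) {x : EuclideanSpace ℝ (Fin n)}
    (hx : x ∈ D) :
    Tendsto (fun p : ℝ × ℝ => transport f D p.1 p.2 g x) (closeTimes T) (𝓝 (g x)) := by
  obtain ⟨M, hM⟩ := hf.exists_speed
  obtain ⟨δ, hδ, hstay⟩ := hf.exists_mem_survivalSet hDo hx
  have h0 := (tendsto_sub_closeTimes (T := T)).abs
  rw [abs_zero] at h0
  have h1 : Tendsto (fun p : ℝ × ℝ => flow f p.1 p.2 x) (closeTimes T) (𝓝 x) := by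
    rw [tendsto_iff_norm_sub_tendsto_zero]
    refine squeeze_zero (fun _ => norm_nonneg _) (fun p => hf.norm_flow_sub_le hM p.1 p.2 x) ?_
    simpa using h0.const_mul (M : ℝ)
  refine ((hg.tendsto x).comp h1).congr' ?_
  filter_upwards [h0.eventually_lt_const hδ] with p hp
  rw [transport, indicator_of_mem (hstay _ _ hp)]
  rfl

lemma IsC1Field.tendsto_transport_of_continuous (hf : IsC1Field f) (hDo : IsOpen D)
    (hDb : Bornology.IsBounded D) {g : EuclideanSpace ℝ (Fin n) → ℝ} (hg : Continuous g)
    {C : ℝ} (hC : ∀ x, ‖g x‖ ≤ C) :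
    Tendsto (fun p : ℝ × ℝ => eLpNorm (transport f D p.1 p.2 g - g) 2 (volume.restrict D))
      (closeTimes T) (𝓝 0) := by
  have hC0 : 0 ≤ C := (norm_nonneg _).trans (hC 0)
  have key : Tendsto (fun p : ℝ × ℝ =>
      ∫⁻ x in D, ‖transport f D p.1 p.2 g x - g x‖ₑ ^ (2 : ℝ)) (closeTimes T)
      (𝓝 (∫⁻ x in D, 0)) := by
    refine tendsto_lintegral_filter_of_dominated_convergence
      (fun _ => ENNReal.ofReal (2 * C) ^ (2 : ℝ)) (Eventually.of_forall fun p => ?_)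
      (Eventually.of_forall fun p => Eventually.of_forall fun x => ?_) ?_ ?_
    · have h1 : Measurable (transport f D p.1 p.2 g) :=
        ((hg.comp (hf.continuous_flow_space p.1 p.2)).measurable).indicator
          (hf.isOpen_survivalSet hDo p.1 p.2).measurableSet
      exact (h1.sub hg.measurable).enorm.pow_const _
    · refine ENNReal.rpow_le_rpow ?_ (by norm_num)
      rw [← ofReal_norm]
      refine ENNReal.ofReal_le_ofReal ((norm_sub_le _ _).trans ?_)
      have h1 : ‖transport f D p.1 p.2 g x‖ ≤ C := by
        by_cases hx : x ∈ survivalSet f D p.1 p.2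
        · rw [transport, indicator_of_mem hx]; exact hC _
        · rw [transport, indicator_of_notMem hx, norm_zero]; exact hC0
      linarith [hC x]
    · rw [lintegral_const, Measure.restrict_apply_univ]
      exact ENNReal.mul_ne_top (ENNReal.rpow_ne_top_of_nonneg (by norm_num) ENNReal.ofReal_ne_top)
        hDb.measure_lt_top.ne
    · refine (ae_restrict_iff' hDo.measurableSet).2 (Eventually.of_forall fun x hx => ?_)
      have h1 := ((hf.tendsto_transport_apply (T := T) hDo hg hx).sub_const (g x)).enorm
      rw [sub_self, enorm_zero] at h1
      have h2 := (ENNReal.continuous_rpow_const (y := 2)).tendsto 0 |>.comp h1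
      rwa [ENNReal.zero_rpow_of_pos (by norm_num)] at h2
  rw [lintegral_zero] at key
  have h2 := (ENNReal.continuous_rpow_const (y := 1 / 2)).tendsto 0 |>.comp key
  rw [ENNReal.zero_rpow_of_pos (by norm_num)] at h2
  refine h2.congr fun p => ?_
  rw [eLpNorm_eq_lintegral_rpow_enorm_toReal (by norm_num) (by norm_num)]
  simp

/-- Strong continuity of the transport operators, uniformly in the initial time: continuous
functions are handled by dominated convergence, and they are dense in `L₂(D)`. -/
lemma IsC1Field.tendsto_transport (hf : IsC1Field f) (hDo : IsOpen D)
    (hDb : Bornology.IsBounded D) {g : EuclideanSpace ℝ (Fin n) → ℝ}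
    (hg : MemLp g 2 (volume.restrict D)) :
    Tendsto (fun p : ℝ × ℝ => eLpNorm (transport f D p.1 p.2 g - g) 2 (volume.restrict D))
      (closeTimes T) (𝓝 0) := by
  rw [ENNReal.tendsto_nhds_zero]
  intro ε hε
  set c := ENNReal.ofReal (growthConstant f D T) with hc
  have : IsFiniteMeasure (volume.restrict D) := ⟨by simpa using hDb.measure_lt_top⟩
  obtain ⟨k, hk_supp, hk, hk_cont, hk_mem⟩ := hg.exists_hasCompactSupport_eLpNorm_sub_le
    (by norm_num) (ε := ε / 2 / (c + 1)) (by
      refine ENNReal.div_ne_zero.2 ⟨ENNReal.div_ne_zero.2 ⟨hε.ne', by norm_num⟩, ?_⟩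
      exact ENNReal.add_ne_top.2 ⟨ENNReal.ofReal_ne_top, ENNReal.one_ne_top⟩)
  obtain ⟨C, hC⟩ := hk_cont.bounded_above_of_compact_support hk_supp
  have h1 := hf.tendsto_transport_of_continuous (T := T) hDo hDb hk_cont hC
  filter_upwards [ENNReal.tendsto_nhds_zero.1 h1 (ε / 2) (by simpa using hε.ne'),
    eventually_mem_closeTimes] with p hp hmem
  have hsub : transport f D p.1 p.2 g - g =
      transport f D p.1 p.2 (g - k) + ((transport f D p.1 p.2 k - k) + (k - g)) := by
    rw [transport_sub]; abel
  have hm1 := hf.aestronglyMeasurable_transport hDo hDb hmem.1 hmem.2 (hg.sub hk_mem).1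
  have hm2 := hf.aestronglyMeasurable_transport hDo hDb hmem.1 hmem.2 hk_mem.1
  calc eLpNorm (transport f D p.1 p.2 g - g) 2 (volume.restrict D)
      ≤ eLpNorm (transport f D p.1 p.2 (g - k)) 2 (volume.restrict D)
        + (eLpNorm (transport f D p.1 p.2 k - k) 2 (volume.restrict D)
          + eLpNorm (k - g) 2 (volume.restrict D)) := by
        rw [hsub]
        refine (eLpNorm_add_le hm1 ((hm2.sub hk_mem.1).add (hk_mem.1.sub hg.1))
          (by norm_num)).trans ?_
        gcongr
        exact eLpNorm_add_le (hm2.sub hk_mem.1) (hk_mem.1.sub hg.1) (by norm_num)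
    _ ≤ c * eLpNorm (g - k) 2 (volume.restrict D)
        + (ε / 2 + eLpNorm (g - k) 2 (volume.restrict D)) := by
        rw [eLpNorm_sub_comm k g]
        gcongr
        exact hf.eLpNorm_transport_le hDo hDb hmem.1 hmem.2 (hg.sub hk_mem).1
    _ = (c + 1) * eLpNorm (g - k) 2 (volume.restrict D) + ε / 2 := by ring
    _ ≤ (c + 1) * (ε / 2 / (c + 1)) + ε / 2 := by gcongr
    _ ≤ ε / 2 + ε / 2 := by gcongr; exact ENNReal.mul_div_le
    _ = ε := ENNReal.add_halves ε

/-- Up to the distortion of volume, `transport f D b a` is the adjoint of `transport f D a b`. -/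
lemma IsC1Field.enorm_integral_transport_sub_le (hf : IsC1Field f) (hDo : IsOpen D)
    (hDb : Bornology.IsBounded D) {a b : ℝ} (ha : a ∈ Icc 0 T) (hb : b ∈ Icc 0 T) (hab : a ≤ b)
    {ξ h : EuclideanSpace ℝ (Fin n) → ℝ} (hξ : MemLp ξ 2 (volume.restrict D))
    (hh : MemLp h 2 (volume.restrict D)) :
    ‖(∫ x in D, transport f D b a ξ x * h x) - ∫ x in D, ξ x * transport f D a b h x‖ₑ ≤
      ENNReal.ofReal (Real.exp (∫ t in a..b, supDivergence f D t) - 1) *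
        (eLpNorm ξ 2 (volume.restrict D) *
          (ENNReal.ofReal (growthConstant f D T) * eLpNorm h 2 (volume.restrict D))) := by
  have hAm : MeasurableSet (survivalSet f D a b) := (hf.isOpen_survivalSet hDo a b).measurableSet
  have hBm : MeasurableSet (survivalSet f D b a) := (hf.isOpen_survivalSet hDo b a).measurableSet
  have hder : ∀ x ∈ survivalSet f D a b, HasFDerivWithinAt (flow f a b)
      (fderiv ℝ (flow f a b) x) (survivalSet f D a b) x := fun x _ =>
    (hf.hasFDerivAt_flow hab x).hasFDerivWithinAt
  have hTh := hf.memLp_transport hDo hDb ha hb hh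
  have hTξ := hf.memLp_transport hDo hDb hb ha hξ
  set G : EuclideanSpace ℝ (Fin n) → ℝ := fun z => ξ (flow f b a z) * h z with hG
  have e1 : ∀ x, transport f D b a ξ x * h x = (survivalSet f D b a).indicator G x := fun x => by
    by_cases hx : x ∈ survivalSet f D b a <;> simp [transport, hx, hG]
  have e2 : ∀ x, ξ x * transport f D a b h x =
      (survivalSet f D a b).indicator (fun x => ξ x * h (flow f a b x)) x := fun x => by
    by_cases hx : x ∈ survivalSet f D a b <;> simp [transport, hx]
  have i1 : IntegrableOn G (survivalSet f D b a) := by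
    have := hTξ.integrable_mul hh
    rw [show transport f D b a ξ * h = (survivalSet f D b a).indicator G from funext e1,
      integrable_indicator_iff hBm, IntegrableOn, hf.restrict_survivalSet hDo] at this
    exact this
  have i2 : IntegrableOn (fun x => ξ x * h (flow f a b x)) (survivalSet f D a b) := by
    have := hξ.integrable_mul hTh
    rw [show ξ * transport f D a b h = _ from funext e2,
      integrable_indicator_iff hAm, IntegrableOn, hf.restrict_survivalSet hDo] at this
    exact this
  have i3 := i1
  rw [← hf.image_survivalSet a b, integrableOn_image_iff_integrableOn_abs_det_fderiv_smul _ hAm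
    hder (hf.injective_flow a b).injOn] at i3
  have c1 : ∫ x in D, transport f D b a ξ x * h x = ∫ x in survivalSet f D a b,
      |(fderiv ℝ (flow f a b) x).det| • G (flow f a b x) := by
    simp_rw [e1]
    rw [integral_indicator hBm, hf.restrict_survivalSet hDo, ← hf.image_survivalSet a b,
      integral_image_eq_integral_abs_det_fderiv_smul _ hAm hder (hf.injective_flow a b).injOn]
  have c2 : ∫ x in D, ξ x * transport f D a b h x =
      ∫ x in survivalSet f D a b, ξ x * h (flow f a b x) := by
    simp_rw [e2]
    rw [integral_indicator hAm, hf.restrict_survivalSet hDo]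
  rw [c1, c2, ← integral_sub i3 i2]
  refine (enorm_integral_le_lintegral_enorm _).trans ?_
  calc ∫⁻ x in survivalSet f D a b, ‖|(fderiv ℝ (flow f a b) x).det| • G (flow f a b x)
        - ξ x * h (flow f a b x)‖ₑ
      ≤ ∫⁻ x in survivalSet f D a b,
        ENNReal.ofReal (Real.exp (∫ t in a..b, supDivergence f D t) - 1) *
          ‖ξ x * transport f D a b h x‖ₑ := by
        refine setLIntegral_mono' hAm fun x hx => ?_
        have h1 := abs_le.1 (hf.abs_integral_divergence_le hDb hab hx)
        simp only [hG]
        rw [smul_eq_mul, hf.flow_flow_self, transport, indicator_of_mem hx, ← sub_one_mul,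
          enorm_mul, ← ofReal_norm (|_| - 1)]
        gcongr
        rw [hf.abs_det_fderiv_flow hab, Real.norm_eq_abs, abs_le]
        generalize (∫ t in a..b, supDivergence f D t) = q at h1 ⊢
        generalize (∫ t in a..b, divergence f (flow f a t x) t) = r at h1 ⊢
        refine ⟨?_, by linarith [Real.exp_le_exp.2 h1.2]⟩
        -- `exp q + exp r ≥ exp q + exp (-q) ≥ 2`
        have h2 := Real.exp_le_exp.2 h1.1
        have h3 := Real.add_one_le_exp q
        have h4 := Real.add_one_le_exp (-q)
        linarith
    _ = ENNReal.ofReal (Real.exp (∫ t in a..b, supDivergence f D t) - 1) *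
        ∫⁻ x in survivalSet f D a b, ‖ξ x * transport f D a b h x‖ₑ :=
        lintegral_const_mul' _ _ ENNReal.ofReal_ne_top
    _ ≤ ENNReal.ofReal (Real.exp (∫ t in a..b, supDivergence f D t) - 1) *
        ∫⁻ x in D, ‖ξ x * transport f D a b h x‖ₑ := by
        gcongr
        exact hf.survivalSet_subset a b
    _ ≤ _ := by
        gcongr
        refine (lintegral_enorm_mul_le hξ.1 hTh.1).trans ?_
        gcongr
        exact hf.eLpNorm_transport_le hDo hDb ha hb hh.1

/-- The factor that bounds the functional `h ↦ ⟨ξ, T_{a,b} h - h⟩` on `L₂(D)` at `p = (a, b)`. -/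
noncomputable def weakModulus (f : EuclideanSpace ℝ (Fin n) → ℝ → EuclideanSpace ℝ (Fin n))
    (D : Set (EuclideanSpace ℝ (Fin n))) (T : ℝ) (ξ : EuclideanSpace ℝ (Fin n) → ℝ)
    (p : ℝ × ℝ) : ℝ≥0∞ :=
  eLpNorm (transport f D p.2 p.1 ξ - ξ) 2 (volume.restrict D) +
    ENNReal.ofReal (Real.exp (∫ t in p.1..p.2, supDivergence f D t) - 1) *
      (eLpNorm ξ 2 (volume.restrict D) * ENNReal.ofReal (growthConstant f D T))

lemma IsC1Field.enorm_integral_mul_sub_transport_le (hf : IsC1Field f) (hDo : IsOpen D)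
    (hDb : Bornology.IsBounded D) {a b : ℝ} (ha : a ∈ Icc 0 T) (hb : b ∈ Icc 0 T) (hab : a ≤ b)
    {ξ h : EuclideanSpace ℝ (Fin n) → ℝ} (hξ : MemLp ξ 2 (volume.restrict D))
    (hh : MemLp h 2 (volume.restrict D)) :
    ‖∫ x in D, ξ x * (transport f D a b h x - h x)‖ₑ ≤
      weakModulus f D T ξ (a, b) * eLpNorm h 2 (volume.restrict D) := by
  have hTh := hf.memLp_transport hDo hDb ha hb hh
  have hTξ := hf.memLp_transport hDo hDb hb ha hξ
  have e : ∫ x in D, ξ x * (transport f D a b h x - h x) =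
      (∫ x in D, (transport f D b a ξ - ξ) x * h x) -
        ((∫ x in D, transport f D b a ξ x * h x) - ∫ x in D, ξ x * transport f D a b h x) := by
    have hd : Integrable (fun x => transport f D b a ξ x * h x - ξ x * transport f D a b h x)
        (volume.restrict D) := (integrable_fun_mul hTξ hh).sub (integrable_fun_mul hξ hTh)
    rw [← integral_sub (integrable_fun_mul hTξ hh) (integrable_fun_mul hξ hTh),
      ← integral_sub (integrable_fun_mul (hTξ.sub hξ) hh) hd]
    refine integral_congr_ae (Eventually.of_forall fun x => ?_)
    simp only [Pi.sub_apply]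
    ring
  rw [e]
  refine (enorm_sub_le).trans ?_
  rw [weakModulus, add_mul]
  refine add_le_add (enorm_integral_mul_le (hTξ.sub hξ).1 hh.1) ?_
  refine (hf.enorm_integral_transport_sub_le hDo hDb ha hb hab hξ hh).trans_eq ?_
  ring

lemma IsC1Field.tendsto_weakModulus (hf : IsC1Field f) (hDo : IsOpen D)
    (hDb : Bornology.IsBounded D) {ξ : EuclideanSpace ℝ (Fin n) → ℝ}
    (hξ : MemLp ξ 2 (volume.restrict D)) :
    Tendsto (weakModulus f D T ξ) (closeTimes T) (𝓝 0) := by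
  have h1 := (hf.tendsto_transport (T := T) hDo hDb hξ).comp tendsto_swap_closeTimes
  obtain ⟨C, hC0, hC⟩ := hf.exists_supDivergence_le hDb 0 T
  have h2 : Tendsto (fun p : ℝ × ℝ => ∫ t in p.1..p.2, supDivergence f D t) (closeTimes T)
      (𝓝 0) := by
    have h0 := (tendsto_sub_closeTimes (T := T)).abs.const_mul C
    rw [abs_zero, mul_zero] at h0
    refine squeeze_zero_norm' ?_ h0
    filter_upwards [eventually_mem_closeTimes] with p hp
    refine intervalIntegral.norm_integral_le_of_norm_le_const fun t ht => ?_
    rw [Real.norm_eq_abs, abs_of_nonneg (supDivergence_nonneg t)]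
    exact hC t (uIcc_subset_Icc hp.1 hp.2 (uIoc_subset_uIcc ht))
  have h3 : Tendsto (fun p : ℝ × ℝ =>
      ENNReal.ofReal (Real.exp (∫ t in p.1..p.2, supDivergence f D t) - 1)) (closeTimes T)
      (𝓝 0) := by
    have := ((Real.continuous_exp.tendsto 0).comp h2).sub_const 1
    rw [Real.exp_zero, sub_self] at this
    simpa using ENNReal.tendsto_ofReal this
  have h4 := ENNReal.Tendsto.mul_const h3 (b := eLpNorm ξ 2 (volume.restrict D) *
    ENNReal.ofReal (growthConstant f D T))
    (Or.inr (ENNReal.mul_ne_top hξ.2.ne ENNReal.ofReal_ne_top))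
  simpa [weakModulus] using! h1.add h4

/-- A bounded family in `L₂(D)` that satisfies `w(a) = T_{a,b} w(b)`, for the transport operators
`T_{a,b}`, up to an error controlled by the integral over `(a, b)` of an integrable function is
weakly continuous and strongly left-continuous. -/
theorem IsC1Field.continuity_of_transport (hf : IsC1Field f) (hDo : IsOpen D)
    (hDb : Bornology.IsBounded D) {w : EuclideanSpace ℝ (Fin n) → ℝ → ℝ} {ψ : ℝ → ℝ≥0∞}
    (hψ : ∫⁻ t in Ioo 0 T, ψ t ≠ ∞) {B C : ℝ≥0∞} (hB : B ≠ ∞) (hC : C ≠ ∞)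
    (hw : ∀ s ∈ Icc 0 T, MemLp (fun x => w x s) 2 (volume.restrict D))
    (hwB : ∀ s ∈ Icc 0 T, eLpNorm (fun x => w x s) 2 (volume.restrict D) ≤ B)
    (hwT : ∀ a ∈ Icc 0 T, ∀ b ∈ Icc 0 T, a ≤ b →
      eLpNorm ((fun x => w x a) - transport f D a b fun x => w x b) 2 (volume.restrict D) ≤
        C * ∫⁻ t in Ioo a b, ψ t) :
    WeaklyContinuousL2 D T w ∧ StronglyLeftContinuousL2 D T w := by
  have hψ0 : Tendsto (fun p : ℝ × ℝ => C * ∫⁻ t in Ioo p.1 p.2, ψ t) (closeTimes T) (𝓝 0) := by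
    have h1 : Tendsto ((volume.restrict (Ioo 0 T)) ∘ fun p : ℝ × ℝ => Ioo p.1 p.2)
        (closeTimes T) (𝓝 0) := by
      have h2 := ENNReal.tendsto_ofReal (tendsto_sub_closeTimes (T := T))
      rw [ENNReal.ofReal_zero] at h2
      refine tendsto_of_tendsto_of_tendsto_of_le_of_le tendsto_const_nhds h2
        (fun _ => zero_le) fun p => ?_
      exact (Measure.restrict_apply_le _ _).trans_eq Real.volume_Ioo
    have h2 := tendsto_setLIntegral_zero hψ h1
    have h3 := ENNReal.Tendsto.const_mul h2 (Or.inr hC)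
    rw [mul_zero] at h3
    refine h3.congr' ?_
    filter_upwards [eventually_mem_closeTimes] with p hp
    rw [Measure.restrict_restrict measurableSet_Ioo, inter_eq_left.2]
    exact Ioo_subset_Ioo hp.1.1 hp.2.2
  refine ⟨⟨hw, fun ξ hξ => ?_⟩, hw, fun t ht => ?_⟩
  · set m : ℝ × ℝ → ℝ≥0∞ := fun p => eLpNorm ξ 2 (volume.restrict D) *
      (C * ∫⁻ t in Ioo p.1 p.2, ψ t) + weakModulus f D T ξ p * B with hm
    have hm0 : Tendsto m (closeTimes T) (𝓝 0) := by
      have h1 := ENNReal.Tendsto.const_mul hψ0 (a := eLpNorm ξ 2 (volume.restrict D))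
        (Or.inr hξ.2.ne)
      have h2 := ENNReal.Tendsto.mul_const (hf.tendsto_weakModulus (T := T) hDo hDb hξ) (b := B)
        (Or.inr hB)
      simpa using h1.add h2
    have hle : ∀ a ∈ Icc 0 T, ∀ b ∈ Icc 0 T, a ≤ b →
        edist (∫ x in D, ξ x * w x a) (∫ x in D, ξ x * w x b) ≤ m (a, b) := by
      intro a ha b hb hab
      have hTw := hf.memLp_transport hDo hDb ha hb (hw b hb)
      have e : (∫ x in D, ξ x * w x a) - (∫ x in D, ξ x * w x b) =
          (∫ x in D, ξ x * ((fun x => w x a) - transport f D a b fun x => w x b) x) +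
            ∫ x in D, ξ x * ((transport f D a b fun x => w x b) x - w x b) := by
        have hd : Integrable (fun x => ξ x * ((transport f D a b fun x => w x b) x - w x b))
            (volume.restrict D) := integrable_fun_mul hξ (hTw.sub (hw b hb))
        rw [← integral_sub (integrable_fun_mul hξ (hw a ha)) (integrable_fun_mul hξ (hw b hb)),
          ← integral_add (integrable_fun_mul hξ ((hw a ha).sub hTw)) hd]
        refine integral_congr_ae (Eventually.of_forall fun x => ?_)
        simp only [Pi.sub_apply]
        ring
      rw [edist_eq_enorm_sub, e]
      refine (enorm_add_le _ _).trans (add_le_add ?_ ?_)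
      · refine (enorm_integral_mul_le hξ.1 ((hw a ha).sub hTw).1).trans ?_
        gcongr
        exact hwT a ha b hb hab
      · refine (hf.enorm_integral_mul_sub_transport_le hDo hDb ha hb hab hξ (hw b hb)).trans ?_
        gcongr
        exact hwB b hb
    intro t ht
    have hst : Tendsto (fun s : ℝ => s - t) (𝓝[Icc 0 T] t) (𝓝 0) := by
      have : Tendsto (fun s : ℝ => s - t) (𝓝 t) (𝓝 0) := by
        simpa using (continuous_id.sub continuous_const).tendsto (x := t) (f := fun s : ℝ => s - t)
      exact this.mono_left nhdsWithin_le_nhds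
    have h1 : Tendsto (fun s => (t, s)) (𝓝[Icc 0 T] t) (closeTimes T) :=
      tendsto_closeTimes hst (Eventually.of_forall fun _ => ht) self_mem_nhdsWithin
    have h2 := (hm0.comp h1).add (hm0.comp (tendsto_swap_closeTimes.comp h1))
    rw [add_zero] at h2
    rw [ContinuousWithinAt, tendsto_iff_edist_tendsto_0]
    refine tendsto_of_tendsto_of_tendsto_of_le_of_le' tendsto_const_nhds h2
      (Eventually.of_forall fun _ => zero_le) ?_
    filter_upwards [self_mem_nhdsWithin] with s hs
    rcases le_total s t with h | h
    · exact (hle s hs t ht h).trans le_add_self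
    · rw [edist_comm]
      exact (hle t ht s hs h).trans le_self_add
  · have htT : t ∈ Icc 0 T := Ioc_subset_Icc_self ht
    have hst : Tendsto (fun θ : ℝ => t - θ) (𝓝[Ico 0 t] t) (𝓝 0) := by
      have : Tendsto (fun s : ℝ => t - s) (𝓝 t) (𝓝 0) := by
        simpa using (continuous_const.sub continuous_id).tendsto (x := t) (f := fun s : ℝ => t - s)
      exact this.mono_left nhdsWithin_le_nhds
    have h1 : Tendsto (fun θ => (θ, t)) (𝓝[Ico 0 t] t) (closeTimes T) :=
      tendsto_closeTimes hst
        (eventually_mem_nhdsWithin.mono fun θ hθ => ⟨hθ.1, hθ.2.le.trans ht.2⟩)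
        (Eventually.of_forall fun _ => htT)
    have h2 := (hψ0.comp h1).add ((hf.tendsto_transport hDo hDb (hw t htT)).comp h1)
    rw [add_zero] at h2
    refine tendsto_of_tendsto_of_tendsto_of_le_of_le' tendsto_const_nhds h2
      (Eventually.of_forall fun _ => zero_le) ?_
    filter_upwards [self_mem_nhdsWithin] with θ hθ
    have hθT : θ ∈ Icc 0 T := ⟨hθ.1, hθ.2.le.trans ht.2⟩
    have hTw := hf.memLp_transport hDo hDb hθT htT (hw t htT)
    have e : (fun x => w x θ - w x t) = ((fun x => w x θ) - transport f D θ t fun x => w x t) +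
        ((transport f D θ t fun x => w x t) - fun x => w x t) := by
      ext x; simp
    change eLpNorm ((fun x => w x t) - fun x => w x θ) 2 _ ≤ _
    rw [eLpNorm_sub_comm]
    change eLpNorm (fun x => w x θ - w x t) 2 _ ≤ _
    rw [e]
    refine (eLpNorm_add_le ((hw θ hθT).sub hTw).1 (hTw.sub (hw t htT)).1 (by norm_num)).trans ?_
    exact add_le_add (hwT θ hθT t htT hθ.2.le) le_rfl

end Continuity


/-! ### Minkowski's integral inequality in `L₂` -/

section Minkowski

variable {α β : Type*} [MeasurableSpace α] [MeasurableSpace β] {ν : Measure α} {μ : Measure β}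
  [SFinite μ] {F : α × β → ℝ}

/-- Minkowski's integral inequality: expand the square of the inner integral, and apply the
Cauchy–Schwarz inequality in `x` for each pair of parameters. -/
lemma eLpNorm_integral_le [SFinite ν] (hF : AEStronglyMeasurable F (ν.prod μ)) :
    eLpNorm (fun x => ∫ t, F (t, x) ∂ν) 2 μ ≤ ∫⁻ t, eLpNorm (fun x => F (t, x)) 2 μ ∂ν := by
  set I := ∫⁻ t, eLpNorm (fun x => F (t, x)) 2 μ ∂ν with hI
  set G : β → ℝ≥0∞ := fun x => ∫⁻ t, ‖F (t, x)‖ₑ ∂ν with hG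
  have hGm : AEMeasurable G μ := hF.enorm.lintegral_prod_left'
  have hsec : ∀ᵐ t ∂ν, AEStronglyMeasurable (fun x => F (t, x)) μ := hF.prodMk_left
  have hinner : ∀ᵐ t ∂ν, ∫⁻ x, ‖F (t, x)‖ₑ * G x ∂μ ≤ eLpNorm (fun x => F (t, x)) 2 μ * I := by
    filter_upwards [hsec] with t ht
    have h1 : ∀ x, ‖F (t, x)‖ₑ * G x = ∫⁻ r, ‖F (t, x)‖ₑ * ‖F (r, x)‖ₑ ∂ν := fun x =>
      (lintegral_const_mul' _ _ enorm_ne_top).symm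
    simp_rw [h1]
    have hm : AEMeasurable (Function.uncurry fun (x : β) (r : α) => ‖F (t, x)‖ₑ * ‖F (r, x)‖ₑ)
        (μ.prod ν) := (ht.enorm.comp_fst).mul hF.prod_swap.enorm
    rw [lintegral_lintegral_swap hm, hI, mul_comm]
    have hle : ∀ᵐ r ∂ν, ∫⁻ x, ‖F (t, x)‖ₑ * ‖F (r, x)‖ₑ ∂μ ≤
        eLpNorm (fun x => F (r, x)) 2 μ * eLpNorm (fun x => F (t, x)) 2 μ := by
      filter_upwards [hsec] with r hr
      rw [mul_comm (eLpNorm _ _ _)]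
      refine le_trans (le_of_eq ?_) (lintegral_enorm_mul_le ht hr)
      simp_rw [enorm_mul]
    refine (lintegral_mono_ae hle).trans_eq (lintegral_mul_const'' _ ?_)
    simp_rw [eLpNorm_eq_lintegral_rpow_enorm_toReal (two_ne_zero) (ENNReal.ofNat_ne_top)]
    exact ((hF.enorm.pow_const _).lintegral_prod_right').pow_const _
  have hsq : ∫⁻ x, G x * G x ∂μ ≤ I * I := by
    calc ∫⁻ x, G x * G x ∂μ ≤ ∫⁻ x, ∫⁻ t, ‖F (t, x)‖ₑ * G x ∂ν ∂μ :=
          lintegral_mono fun x => lintegral_mul_const_le _ _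
      _ = ∫⁻ t, ∫⁻ x, ‖F (t, x)‖ₑ * G x ∂μ ∂ν := by
          refine lintegral_lintegral_swap (f := fun x t => ‖F (t, x)‖ₑ * G x) ?_
          exact hF.prod_swap.enorm.mul hGm.comp_fst
      _ ≤ ∫⁻ t, eLpNorm (fun x => F (t, x)) 2 μ * I ∂ν := lintegral_mono_ae hinner
      _ = I * I := by
          rw [lintegral_mul_const'']
          simp_rw [eLpNorm_eq_lintegral_rpow_enorm_toReal (two_ne_zero) (ENNReal.ofNat_ne_top)]
          exact ((hF.enorm.pow_const _).lintegral_prod_right').pow_const _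
  rw [eLpNorm_eq_lintegral_rpow_enorm_toReal (two_ne_zero) (ENNReal.ofNat_ne_top)]
  calc (∫⁻ x, ‖∫ t, F (t, x) ∂ν‖ₑ ^ (2 : ℝ≥0∞).toReal ∂μ) ^ (1 / (2 : ℝ≥0∞).toReal)
      ≤ (∫⁻ x, G x * G x ∂μ) ^ (1 / (2 : ℝ≥0∞).toReal) := by
        gcongr with x
        rw [ENNReal.toReal_ofNat, ENNReal.rpow_ofNat, sq]
        exact mul_le_mul' (enorm_integral_le_lintegral_enorm _)
          (enorm_integral_le_lintegral_enorm _)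
    _ ≤ (I * I) ^ (1 / (2 : ℝ≥0∞).toReal) := by gcongr
    _ = I := by
        rw [← sq, ← ENNReal.rpow_natCast, ← ENNReal.rpow_mul]
        norm_num

lemma integrable_prod_of_lintegral_eLpNorm [IsFiniteMeasure μ]
    (hF : AEStronglyMeasurable F (ν.prod μ))
    (hfin : ∫⁻ t, eLpNorm (fun x => F (t, x)) 2 μ ∂ν ≠ ∞) : Integrable F (ν.prod μ) := by
  refine ⟨hF, ?_⟩
  rw [HasFiniteIntegral, lintegral_prod _ hF.enorm]
  have h1 : ∀ᵐ t ∂ν, ∫⁻ x, ‖F (t, x)‖ₑ ∂μ ≤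
      eLpNorm (fun x => F (t, x)) 2 μ *
        μ univ ^ (1 / (1 : ℝ≥0∞).toReal - 1 / (2 : ℝ≥0∞).toReal) := by
    filter_upwards [hF.prodMk_left] with t ht
    rw [← eLpNorm_one_eq_lintegral_enorm]
    exact eLpNorm_le_eLpNorm_mul_rpow_measure_univ (by norm_num) ht
  have hμ : μ univ ^ (1 / (1 : ℝ≥0∞).toReal - 1 / (2 : ℝ≥0∞).toReal) ≠ ∞ :=
    ENNReal.rpow_ne_top_of_nonneg (by norm_num) (measure_ne_top _ _)
  refine (lintegral_mono_ae h1).trans_lt ?_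
  rw [lintegral_mul_const' _ _ hμ]
  exact ENNReal.mul_lt_top hfin.lt_top hμ.lt_top

end Minkowski

/-! ### The functionals of the exit problem -/

section Functionals

variable {n : ℕ} {f : EuclideanSpace ℝ (Fin n) → ℝ → EuclideanSpace ℝ (Fin n)}
  {D : Set (EuclideanSpace ℝ (Fin n))} {T : ℝ}

lemma IsC1Field.coe_lt_exitTime_iff (hf : IsC1Field f) (hDo : IsOpen D) {s t : ℝ} (hst : s ≤ t)
    {x : EuclideanSpace ℝ (Fin n)} :
    (t : EReal) < exitTime f D x s ↔ x ∈ survivalSet f D s t := by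
  constructor
  · intro h r hr
    rw [uIcc_of_le hst] at hr
    by_contra hout
    have h1 : exitTime f D x s ≤ r :=
      sInf_le ⟨r, ⟨hr.1, by rwa [hf.trajectory_eq_flow hr.1]⟩, rfl⟩
    exact absurd (h.trans_le h1) (not_lt.2 (EReal.coe_le_coe_iff.2 hr.2))
  · intro hx
    -- `D` being open, the trajectory stays in `D` for some time after `t`
    have hopen : IsOpen {r | flow f s r x ∈ D} := hDo.preimage (hf.continuous_flow_time s x)
    obtain ⟨δ, hδ, hball⟩ := Metric.isOpen_iff.1 hopen t (hx t right_mem_uIcc)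
    have hlt : (t : EReal) < (t + δ : ℝ) := EReal.coe_lt_coe_iff.2 (by linarith)
    refine hlt.trans_le (le_sInf ?_)
    rintro _ ⟨r, ⟨hsr, hout⟩, rfl⟩
    rw [hf.trajectory_eq_flow hsr] at hout
    refine EReal.coe_le_coe_iff.2 (not_lt.1 fun hr => hout ?_)
    rcases le_total r t with hrt | hrt
    · exact hx r (by rw [uIcc_of_le hst]; exact ⟨hsr, hrt⟩)
    · refine hball ?_
      rw [Metric.mem_ball, Real.dist_eq, abs_of_nonneg (by linarith)]
      linarith

lemma coe_le_exitTime (s : ℝ) (x : EuclideanSpace ℝ (Fin n)) : (s : EReal) ≤ exitTime f D x s :=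
  le_sInf (by rintro _ ⟨r, ⟨hsr, -⟩, rfl⟩; exact EReal.coe_le_coe_iff.2 hsr)

lemma coe_stoppedTime {s : ℝ} (hs : s ≤ T) (x : EuclideanSpace ℝ (Fin n)) :
    (stoppedTime f D T x s : EReal) = min (T : EReal) (exitTime f D x s) := by
  refine EReal.coe_toReal (ne_top_of_le_ne_top (EReal.coe_ne_top T) (min_le_left _ _)) ?_
  have h : (s : EReal) ≤ min (T : EReal) (exitTime f D x s) :=
    le_min (EReal.coe_le_coe_iff.2 hs) (coe_le_exitTime s x)
  exact ((EReal.bot_lt_coe s).trans_le h).ne'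

lemma le_stoppedTime {s : ℝ} (hs : s ≤ T) (x : EuclideanSpace ℝ (Fin n)) :
    s ≤ stoppedTime f D T x s := by
  rw [← EReal.coe_le_coe_iff, coe_stoppedTime hs]
  exact le_min (EReal.coe_le_coe_iff.2 hs) (coe_le_exitTime s x)

lemma IsC1Field.Ioo_stoppedTime (hf : IsC1Field f) (hDo : IsOpen D) {s : ℝ} (hs : s ≤ T)
    (x : EuclideanSpace ℝ (Fin n)) :
    Ioo s (stoppedTime f D T x s) = {t | x ∈ survivalSet f D s t} ∩ Ioo s T := by
  ext t
  rw [mem_Ioo, ← EReal.coe_lt_coe_iff (x := t), coe_stoppedTime hs, lt_min_iff,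
    EReal.coe_lt_coe_iff]
  constructor
  · rintro ⟨h1, h2, h3⟩
    exact ⟨(hf.coe_lt_exitTime_iff hDo h1.le).1 h3, h1, h2⟩
  · rintro ⟨h3, h1, h2⟩
    exact ⟨h1, h2, (hf.coe_lt_exitTime_iff hDo h1.le).2 h3⟩

lemma IsC1Field.measurableSet_survival_times (hf : IsC1Field f) (hDo : IsOpen D) (s : ℝ)
    (x : EuclideanSpace ℝ (Fin n)) : MeasurableSet {t | x ∈ survivalSet f D s t} :=
  ((hf.isOpen_survivalSet_prod hDo s).preimage
    (by fun_prop : Continuous fun t : ℝ => (t, x))).measurableSet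

/-- The integrand of `V(x, s)`, extended by zero after the exit time. -/
lemma transport_eq_indicator (φ : EuclideanSpace ℝ (Fin n) → ℝ → ℝ) (s : ℝ)
    (x : EuclideanSpace ℝ (Fin n)) :
    (fun t => transport f D s t (fun z => φ z t) x) =
      {t | x ∈ survivalSet f D s t}.indicator fun t => φ (flow f s t x) t := by
  ext t
  by_cases hx : x ∈ survivalSet f D s t <;> simp [transport, hx]

lemma IsC1Field.integralFunctional_eq (hf : IsC1Field f) (hDo : IsOpen D) {s : ℝ} (hs : s ≤ T)
    (φ : EuclideanSpace ℝ (Fin n) → ℝ → ℝ) (x : EuclideanSpace ℝ (Fin n)) :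
    integralFunctional f D T φ x s =
      ∫ t in Ioo s T, transport f D s t (fun z => φ z t) x := by
  rw [integralFunctional, intervalIntegral.integral_of_le (le_stoppedTime hs x),
    integral_Ioc_eq_integral_Ioo, transport_eq_indicator,
    integral_indicator (hf.measurableSet_survival_times hDo s x),
    Measure.restrict_restrict (hf.measurableSet_survival_times hDo s x),
    ← hf.Ioo_stoppedTime hDo hs]
  refine setIntegral_congr_fun measurableSet_Ioo fun t ht => ?_
  simp only [hf.trajectory_eq_flow ht.1.le]

lemma IsC1Field.intervalIntegrable_iff (hf : IsC1Field f) (hDo : IsOpen D) {s : ℝ} (hs : s ≤ T)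
    (φ : EuclideanSpace ℝ (Fin n) → ℝ → ℝ) (x : EuclideanSpace ℝ (Fin n)) :
    IntervalIntegrable (fun t => φ (trajectory f x s t) t) volume s (stoppedTime f D T x s) ↔
      IntegrableOn (fun t => transport f D s t (fun z => φ z t) x) (Ioo s T) := by
  rw [intervalIntegrable_iff_integrableOn_Ioo_of_le (le_stoppedTime hs x), transport_eq_indicator,
    IntegrableOn, IntegrableOn,
    integrable_indicator_iff (hf.measurableSet_survival_times hDo s x), IntegrableOn,
    Measure.restrict_restrict (hf.measurableSet_survival_times hDo s x),
    ← hf.Ioo_stoppedTime hDo hs]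
  refine integrableOn_congr_fun (fun t ht => ?_) measurableSet_Ioo
  simp only [hf.trajectory_eq_flow ht.1.le]

lemma IsC1Field.terminalFunctional_eq (hf : IsC1Field f) (hDo : IsOpen D) {s : ℝ} (hs : s ≤ T)
    (ζ : EuclideanSpace ℝ (Fin n) → ℝ) (x : EuclideanSpace ℝ (Fin n)) :
    terminalFunctional f D T ζ x s = transport f D s T ζ x := by
  have : {z | (T : EReal) < exitTime f D z s} = survivalSet f D s T :=
    Set.ext fun z => hf.coe_lt_exitTime_iff hDo hs
  simp only [terminalFunctional, transport, this, hf.trajectory_eq_flow hs]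

lemma IsC1Field.transport_transport (hf : IsC1Field f) {s r t : ℝ} (hsr : s ≤ r) (hrt : r ≤ t)
    (g : EuclideanSpace ℝ (Fin n) → ℝ) :
    transport f D s r (transport f D r t g) = transport f D s t g := by
  ext x
  have h := hf.mem_survivalSet_iff_of_le (D := D) hsr hrt (x := x)
  by_cases h1 : x ∈ survivalSet f D s r <;> by_cases h2 : flow f s r x ∈ survivalSet f D r t <;>
    simp [transport, h, h1, h2, hf.flow_flow]

lemma IsC1Field.aestronglyMeasurable_transport_prod (hf : IsC1Field f) (hDo : IsOpen D)
    (hDb : Bornology.IsBounded D) {φ : EuclideanSpace ℝ (Fin n) → ℝ → ℝ}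
    (hφ : AEStronglyMeasurable (fun p : ℝ × EuclideanSpace ℝ (Fin n) => φ p.2 p.1)
      ((volume.restrict (Ioo 0 T)).prod (volume.restrict D))) {s : ℝ} (hs : s ∈ Icc 0 T) :
    AEStronglyMeasurable
      (fun p : ℝ × EuclideanSpace ℝ (Fin n) => transport f D s p.1 (fun z => φ z p.1) p.2)
      ((volume.restrict (Ioo 0 T)).prod (volume.restrict D)) := by
  set S : Set (ℝ × EuclideanSpace ℝ (Fin n)) := {p | p.2 ∈ survivalSet f D s p.1} with hS
  have hSm : MeasurableSet S := (hf.isOpen_survivalSet_prod hDo s).measurableSet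
  set Ψ : ℝ × EuclideanSpace ℝ (Fin n) → ℝ × EuclideanSpace ℝ (Fin n) :=
    fun p => (p.1, flow f s p.1 p.2) with hΨ
  have hΨm : Measurable Ψ := (continuous_fst.prodMk (hf.continuous_flow s)).measurable
  have hq : Measure.QuasiMeasurePreserving Ψ
      (((volume.restrict (Ioo 0 T)).prod (volume.restrict D)).restrict S)
      ((volume.restrict (Ioo 0 T)).prod (volume.restrict D)) := by
    refine ⟨hΨm, Measure.AbsolutelyContinuous.mk fun N hN hN0 => ?_⟩
    rw [Measure.map_apply hΨm hN, Measure.restrict_apply (hΨm hN),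
      Measure.measure_prod_null ((hΨm hN).inter hSm)]
    filter_upwards [(Measure.measure_prod_null hN).1 hN0, ae_restrict_mem measurableSet_Ioo]
      with t ht htT
    have h1 := hf.absolutelyContinuous_map_flow hDo hDb hs (Ioo_subset_Icc_self htT) ht
    rw [Measure.map_apply (hf.continuous_flow_space s t).measurable
      (measurable_prodMk_left hN), ← hf.restrict_survivalSet hDo,
      Measure.restrict_apply ((hf.continuous_flow_space s t).measurable
        (measurable_prodMk_left hN))] at h1
    exact h1
  have heq : (fun p : ℝ × EuclideanSpace ℝ (Fin n) =>
      transport f D s p.1 (fun z => φ z p.1) p.2) =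
      S.indicator ((fun p : ℝ × EuclideanSpace ℝ (Fin n) => φ p.2 p.1) ∘ Ψ) := by
    ext p
    by_cases hp : p.2 ∈ survivalSet f D s p.1 <;> simp [transport, hS, hΨ, hp]
  rw [heq, aestronglyMeasurable_indicator_iff hSm]
  exact hφ.comp_quasiMeasurePreserving hq

lemma IsC1Field.lintegral_eLpNorm_transport_le (hf : IsC1Field f) (hDo : IsOpen D)
    (hDb : Bornology.IsBounded D) {φ : EuclideanSpace ℝ (Fin n) → ℝ → ℝ}
    (hφ : AEStronglyMeasurable (fun p : ℝ × EuclideanSpace ℝ (Fin n) => φ p.2 p.1)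
      ((volume.restrict (Ioo 0 T)).prod (volume.restrict D))) {a b : ℝ} (ha : a ∈ Icc 0 T)
    (hb : b ∈ Icc 0 T) :
    AEStronglyMeasurable
      (fun p : ℝ × EuclideanSpace ℝ (Fin n) => transport f D a p.1 (fun z => φ z p.1) p.2)
      ((volume.restrict (Ioo a b)).prod (volume.restrict D)) ∧
    ∫⁻ t in Ioo a b, eLpNorm (transport f D a t fun z => φ z t) 2 (volume.restrict D) ≤
      ENNReal.ofReal (growthConstant f D T) *
        ∫⁻ t in Ioo a b, eLpNorm (fun x => φ x t) 2 (volume.restrict D) := by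
  have hsub : Ioo a b ⊆ Ioo 0 T := Ioo_subset_Ioo ha.1 hb.2
  have hmono : volume.restrict (Ioo a b) ≤ volume.restrict (Ioo 0 T) :=
    Measure.restrict_mono hsub le_rfl
  constructor
  · refine (hf.aestronglyMeasurable_transport_prod hDo hDb hφ ha).mono_measure ?_
    rw [Measure.prod_restrict, Measure.prod_restrict]
    exact Measure.restrict_mono (prod_mono hsub Subset.rfl) le_rfl
  · rw [← lintegral_const_mul' _ _ ENNReal.ofReal_ne_top]
    refine lintegral_mono_ae ?_
    filter_upwards [ae_mono hmono hφ.prodMk_left, ae_restrict_mem measurableSet_Ioo] with t ht htab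
    exact hf.eLpNorm_transport_le hDo hDb ha (Ioo_subset_Icc_self (hsub htab)) ht

section

variable {φ : EuclideanSpace ℝ (Fin n) → ℝ → ℝ}

lemma IsC1Field.ae_integrableOn_transport (hf : IsC1Field f) (hDo : IsOpen D)
    (hDb : Bornology.IsBounded D)
    (hφ : AEStronglyMeasurable (fun p : ℝ × EuclideanSpace ℝ (Fin n) => φ p.2 p.1)
      ((volume.restrict (Ioo 0 T)).prod (volume.restrict D)))
    (hfin : ∫⁻ t in Ioo 0 T, eLpNorm (fun x => φ x t) 2 (volume.restrict D) ≠ ∞) {s : ℝ}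
    (hs : s ∈ Icc 0 T) :
    ∀ᵐ x ∂(volume.restrict D),
      IntegrableOn (fun t => transport f D s t (fun z => φ z t) x) (Ioo s T) := by
  have hT : T ∈ Icc 0 T := ⟨hs.1.trans hs.2, le_rfl⟩
  have : IsFiniteMeasure (volume.restrict D) := ⟨by simpa using hDb.measure_lt_top⟩
  obtain ⟨hm, hle⟩ := hf.lintegral_eLpNorm_transport_le hDo hDb hφ hs hT
  refine (integrable_prod_of_lintegral_eLpNorm hm (ne_top_of_le_ne_top ?_ hle)).prod_left_ae
  refine ENNReal.mul_ne_top ENNReal.ofReal_ne_top (ne_top_of_le_ne_top hfin ?_)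
  exact lintegral_mono_set (Ioo_subset_Ioo_left hs.1)

lemma IsC1Field.integralFunctional_mem (hf : IsC1Field f) (hDo : IsOpen D)
    (hDb : Bornology.IsBounded D)
    (hφ : AEStronglyMeasurable (fun p : ℝ × EuclideanSpace ℝ (Fin n) => φ p.2 p.1)
      ((volume.restrict (Ioo 0 T)).prod (volume.restrict D)))
    (hfin : ∫⁻ t in Ioo 0 T, eLpNorm (fun x => φ x t) 2 (volume.restrict D) ≠ ∞) {s : ℝ}
    (hs : s ∈ Icc 0 T) :
    eLpNorm (fun x => integralFunctional f D T φ x s) 2 (volume.restrict D) ≤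
      ENNReal.ofReal (growthConstant f D T) *
        ∫⁻ t in Ioo 0 T, eLpNorm (fun x => φ x t) 2 (volume.restrict D) ∧
    MemLp (fun x => integralFunctional f D T φ x s) 2 (volume.restrict D) := by
  have hT : T ∈ Icc 0 T := ⟨hs.1.trans hs.2, le_rfl⟩
  obtain ⟨hm, hle⟩ := hf.lintegral_eLpNorm_transport_le hDo hDb hφ hs hT
  have hbound : eLpNorm (fun x => integralFunctional f D T φ x s) 2 (volume.restrict D) ≤
      ENNReal.ofReal (growthConstant f D T) *
        ∫⁻ t in Ioo 0 T, eLpNorm (fun x => φ x t) 2 (volume.restrict D) := by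
    simp_rw [hf.integralFunctional_eq hDo hs.2]
    refine (eLpNorm_integral_le hm).trans (hle.trans ?_)
    gcongr
    exact hs.1
  refine ⟨hbound, ?_, hbound.trans_lt (ENNReal.mul_lt_top ENNReal.ofReal_lt_top hfin.lt_top)⟩
  simp_rw [hf.integralFunctional_eq hDo hs.2]
  exact hm.prod_swap.integral_prod_right'

/-- The dynamic programming identity `V(a) = ∫_a^b T_{a,t} φ(t) dt + T_{a,b} V(b)`. -/
lemma IsC1Field.integralFunctional_sub_transport (hf : IsC1Field f) (hDo : IsOpen D) {a b : ℝ}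
    (hab : a ≤ b) (hb : b ≤ T) {x : EuclideanSpace ℝ (Fin n)}
    (hx : IntegrableOn (fun t => transport f D a t (fun z => φ z t) x) (Ioo a T)) :
    integralFunctional f D T φ x a -
        transport f D a b (fun z => integralFunctional f D T φ z b) x =
      ∫ t in Ioo a b, transport f D a t (fun z => φ z t) x := by
  have haT := hab.trans hb
  set k : ℝ → ℝ := fun t => transport f D a t (fun z => φ z t) x with hk
  have h2 : transport f D a b (fun z => integralFunctional f D T φ z b) x =
      ∫ t in Ioo b T, k t := by
    have e : ∀ t ∈ Ioo b T, k t =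
        transport f D a b (transport f D b t fun z => φ z t) x := fun t ht => by
      rw [hf.transport_transport hab ht.1.le]
    rw [setIntegral_congr_fun measurableSet_Ioo e]
    by_cases hA : x ∈ survivalSet f D a b
    · have e' : ∀ g : EuclideanSpace ℝ (Fin n) → ℝ, transport f D a b g x = g (flow f a b x) :=
        fun g => indicator_of_mem hA _
      simp_rw [e', hf.integralFunctional_eq hDo hb]
    · have e' : ∀ g : EuclideanSpace ℝ (Fin n) → ℝ, transport f D a b g x = 0 :=
        fun g => indicator_of_notMem hA _
      simp_rw [e', integral_zero]
  have hi : IntervalIntegrable k volume a T :=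
    (intervalIntegrable_iff_integrableOn_Ioo_of_le haT).2 hx
  have hbm : b ∈ uIcc a T := by rw [uIcc_of_le haT]; exact ⟨hab, hb⟩
  have hsplit := intervalIntegral.integral_add_adjacent_intervals
    (hi.mono_set (uIcc_subset_uIcc_left hbm)) (hi.mono_set (uIcc_subset_uIcc_right hbm))
  rw [intervalIntegral.integral_of_le hab, intervalIntegral.integral_of_le hb,
    intervalIntegral.integral_of_le haT, integral_Ioc_eq_integral_Ioo,
    integral_Ioc_eq_integral_Ioo, integral_Ioc_eq_integral_Ioo] at hsplit
  rw [hf.integralFunctional_eq hDo haT, h2]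
  exact sub_eq_of_eq_add hsplit.symm

theorem IsC1Field.continuity_integralFunctional (hf : IsC1Field f) (hDo : IsOpen D)
    (hDb : Bornology.IsBounded D)
    (hφ : AEStronglyMeasurable (fun p : ℝ × EuclideanSpace ℝ (Fin n) => φ p.2 p.1)
      ((volume.restrict (Ioo 0 T)).prod (volume.restrict D)))
    (hfin : ∫⁻ t in Ioo 0 T, eLpNorm (fun x => φ x t) 2 (volume.restrict D) ≠ ∞) :
    WeaklyContinuousL2 D T (integralFunctional f D T φ) ∧
      StronglyLeftContinuousL2 D T (integralFunctional f D T φ) := by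
  refine hf.continuity_of_transport hDo hDb hfin
    (ENNReal.mul_ne_top ENNReal.ofReal_ne_top hfin)
    (C := ENNReal.ofReal (growthConstant f D T)) ENNReal.ofReal_ne_top
    (fun s hs => (hf.integralFunctional_mem hDo hDb hφ hfin hs).2)
    (fun s hs => (hf.integralFunctional_mem hDo hDb hφ hfin hs).1) fun a ha b hb hab => ?_
  obtain ⟨hm, hle⟩ := hf.lintegral_eLpNorm_transport_le hDo hDb hφ ha hb
  refine le_trans (le_of_eq (eLpNorm_congr_ae ?_)) ((eLpNorm_integral_le hm).trans hle)
  filter_upwards [hf.ae_integrableOn_transport hDo hDb hφ hfin ha] with x hx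
  exact hf.integralFunctional_sub_transport hDo hab hb.2 hx

end

section

variable {ζ : EuclideanSpace ℝ (Fin n) → ℝ}

lemma IsC1Field.terminalFunctional_mem (hf : IsC1Field f) (hDo : IsOpen D)
    (hDb : Bornology.IsBounded D) (hζ : MemLp ζ 2 (volume.restrict D)) {s : ℝ}
    (hs : s ∈ Icc 0 T) :
    eLpNorm (fun x => terminalFunctional f D T ζ x s) 2 (volume.restrict D) ≤
      ENNReal.ofReal (growthConstant f D T) * eLpNorm ζ 2 (volume.restrict D) ∧
    MemLp (fun x => terminalFunctional f D T ζ x s) 2 (volume.restrict D) := by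
  have hT : T ∈ Icc 0 T := ⟨hs.1.trans hs.2, le_rfl⟩
  simp_rw [hf.terminalFunctional_eq hDo hs.2]
  exact ⟨hf.eLpNorm_transport_le hDo hDb hs hT hζ.1, hf.memLp_transport hDo hDb hs hT hζ⟩

theorem IsC1Field.continuity_terminalFunctional (hf : IsC1Field f) (hDo : IsOpen D)
    (hDb : Bornology.IsBounded D) (hζ : MemLp ζ 2 (volume.restrict D)) :
    WeaklyContinuousL2 D T (terminalFunctional f D T ζ) ∧
      StronglyLeftContinuousL2 D T (terminalFunctional f D T ζ) := by
  refine hf.continuity_of_transport hDo hDb (ψ := 0) (by simp)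
    (ENNReal.mul_ne_top ENNReal.ofReal_ne_top hζ.2.ne) ENNReal.one_ne_top
    (fun s hs => (hf.terminalFunctional_mem hDo hDb hζ hs).2)
    (fun s hs => (hf.terminalFunctional_mem hDo hDb hζ hs).1) fun a ha b hb hab => ?_
  simp_rw [hf.terminalFunctional_eq hDo ha.2, hf.terminalFunctional_eq hDo hb.2]
  change eLpNorm (transport f D a T ζ - transport f D a b (transport f D b T ζ)) 2 _ ≤ _
  rw [hf.transport_transport hab hb.2, sub_self]
  simp

end

end Functionals

end ExitFlow

theorem corollary4p1 {n : ℕ} (D : Set (EuclideanSpace ℝ (Fin n))) (hD : ExitFlow.IsC1Domain D)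
    (T : ℝ) (hT : 0 < T)
    (f : EuclideanSpace ℝ (Fin n) → ℝ → EuclideanSpace ℝ (Fin n)) (hf : ExitFlow.IsC1Field f)
    (φ : EuclideanSpace ℝ (Fin n) → ℝ → ℝ)
    (hφ_meas : AEStronglyMeasurable (fun p : EuclideanSpace ℝ (Fin n) × ℝ => φ p.1 p.2)
      (volume.restrict (D ×ˢ Ioo 0 T)))
    (hφ_fin : (∫⁻ t in Ioo 0 T, eLpNorm (fun x => φ x t) 2 (volume.restrict D)) ≠ ∞)
    (ζ : EuclideanSpace ℝ (Fin n) → ℝ) (hζ : MemLp ζ 2 (volume.restrict D)) :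
    -- the integral defining `V(·, s)` converges absolutely for almost every starting point
    (∀ s ∈ Icc 0 T, ∀ᵐ x ∂(volume.restrict D),
      IntervalIntegrable (fun t => φ (ExitFlow.trajectory f x s t) t) volume s
        (ExitFlow.stoppedTime f D T x s)) ∧
    ExitFlow.WeaklyContinuousL2 D T (ExitFlow.integralFunctional f D T φ) ∧
    ExitFlow.StronglyLeftContinuousL2 D T (ExitFlow.integralFunctional f D T φ) ∧
    ExitFlow.WeaklyContinuousL2 D T (ExitFlow.terminalFunctional f D T ζ) ∧
    ExitFlow.StronglyLeftContinuousL2 D T (ExitFlow.terminalFunctional f D T ζ) ∧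
    (⨆ s ∈ Icc 0 T, eLpNorm (fun x => ExitFlow.integralFunctional f D T φ x s) 2
        (volume.restrict D))
      ≤ ENNReal.ofReal (ExitFlow.growthConstant f D T) *
        (∫⁻ t in Ioo 0 T, eLpNorm (fun x => φ x t) 2 (volume.restrict D)) ∧
    (⨆ s ∈ Icc 0 T, eLpNorm (fun x => ExitFlow.terminalFunctional f D T ζ x s) 2
        (volume.restrict D))
      ≤ ENNReal.ofReal (ExitFlow.growthConstant f D T) * eLpNorm ζ 2 (volume.restrict D) := by
  have hDo := hD.isOpen
  have hDb := hD.isBounded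
  have hφ : AEStronglyMeasurable (fun p : ℝ × EuclideanSpace ℝ (Fin n) => φ p.2 p.1)
      ((volume.restrict (Ioo 0 T)).prod (volume.restrict D)) := by
    rw [Measure.volume_eq_prod, ← Measure.prod_restrict] at hφ_meas
    exact hφ_meas.prod_swap
  have hV := hf.continuity_integralFunctional hDo hDb hφ hφ_fin
  have hU := hf.continuity_terminalFunctional (T := T) hDo hDb hζ
  refine ⟨fun s hs => ?_, hV.1, hV.2, hU.1, hU.2,
    iSup₂_le fun s hs => (hf.integralFunctional_mem hDo hDb hφ hφ_fin hs).1,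
    iSup₂_le fun s hs => (hf.terminalFunctional_mem hDo hDb hζ hs).1⟩
  filter_upwards [hf.ae_integrableOn_transport hDo hDb hφ hφ_fin hs] with x hx
  exact (hf.intervalIntegrable_iff hDo hs.2 φ x).2 hx
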